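/- Let $J$ be the half line Jacobi matrix $(Ju)(n)=a(n)u(n+1)+a(n-1)u(n-1)+b(n)u(n)$ ($n\ge 1$, with $u(0):=0$) on $\ell_2(\mathbb Z_+)$, $\mathbb Z_+=\{1,2,\ldots\}$, with real coefficients satisfying, for some $C>0$, $(C+1)^{-1}\le a(n)\le C+1$ and $|b(n)|\le C$ for all $n\ge 1$; put $a(0)=1$. Let $\delta_n$ be the standard unit vectors and $E$ the spectral resolution of $J$. A Herglotz function is a holomorphic map of $\mathbb C^+=\{z:\operatorname{Im}z>0\}$ to itself; $\ln$ denotes the principal logarithm. For $z\in\mathbb C^+$ let $f_\pm(\cdot,z)$ solve $a(n)f(n+1)+a(n-1)f(n-1)+b(n)f(n)=zf(n)$, $n\ge 1$, with $f_-(0,z)=0$, $f_-(1,z)=1$, $f_+(0,z)=1$, $f_+(1,z)=-\langle\delta_1,(J-z)^{-1}\delta_1\rangle$, and put $m_\pm(n,z)=\mp\frac{f_\pm(n+1,z)}{a(n)f_\pm(n,z)}$. For $N\ge 1$ define $$w_\pm^{(N)}(z)=\frac1N\sum_{n=1}^N\ln[a(n)m_\pm(n,z)],\qquad g_N(z)=\frac1N\sum_{n=1}^N\langle\delta_n,(J-z)^{-1}\delta_n\rangle,$$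 $$d\nu_N(t)=\frac1N\sum_{n=1}^N d\|E(t)\delta_n\|^2,\qquad dk_N=\frac1N\sum_{n=1}^N\delta_{\lambda_n^{(N)}},$$ where $\lambda_1^{(N)},\ldots,\lambda_N^{(N)}$ are the eigenvalues of the restriction of $J$ to $\ell_2(\{1,\ldots,N\})$ with boundary conditions $u(0)=u(N+1)=0$, and in the last formula $\delta_\lambda$ is the unit point mass at $\lambda$. **Theorem 3.2.** Let $N_j\to\infty$ be a sequence of integers such that, as $j\to\infty$: $w_+^{(N_j)}\to w_+$, $w_-^{(N_j)}\to w_-$ and $g_{N_j}\to g$ uniformly on compact subsets of $\mathbb C^+$, for some Herglotz functions $w_+,w_-,g$; $d\nu_{N_j}\to d\nu$ and $dk_{N_j}\to d\widetilde k$ in weak $*$ sense, for some Borel probability measures $\nu,\widetilde k$ on $\mathbb R$; and $(a(1)\cdots a(N_j))^{1/N_j}\to A$ for some $A>0$. Define $\gamma,k:\mathbb C^+\to\mathbb R$ by $w_+(z)=-\gamma(z)+i\pi k(z)$. Then the limit $k(t)\equiv\lim_{y\to0+}k(t+iy)$ exists for every $t\in\mathbb R$, and $k(t)$ is an increasing (that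 is, non-decreasing) function of $t\in\mathbb R$; write $dk$ for its Lebesgue--Stieltjes measure. Moreover, $-iw_+$ and $w_+'$ are Herglotz functions, $d\widetilde k=d\nu=dk$, and for all $z\in\mathbb C^+$ $$w_+(z)+w_-(z)=i\pi,\qquad g(z)=w_+'(z)=\int_{-\infty}^\infty\frac{dk(t)}{t-z},\qquad w_+(z)=\ln A-\int_{-\infty}^\infty\ln(t-z)\,dk(t).$$ -/

import Mathlib

open Filter Topology MeasureTheory Complex
open scoped lp ENNReal CompactlySupported ContinuousLinearMap

noncomputable section

/-- The open upper half plane `ℂ⁺`. -/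
def upperHalf : Set ℂ := {z | 0 < z.im}

/-- Herglotz functions: holomorphic maps of `ℂ⁺` to itself (values off `ℂ⁺` are irrelevant). -/
def IsHerglotz (F : ℂ → ℂ) : Prop :=
  DifferentiableOn ℂ F upperHalf ∧ Set.MapsTo F upperHalf upperHalf

/-- Coefficients of a bounded half line Jacobi matrix on `ℓ²(ℤ₊)`, `ℤ₊ = {1, 2, …}`, with the
convention `a 0 = 1`. The value `b 0` is never used. -/
structure JacobiCoeff where
  a : ℕ → ℝ
  b : ℕ → ℝ
  a_zero : a 0 = 1
  bounded : ∃ C > 0, ∀ n ≥ 1, (C + 1)⁻¹ ≤ a n ∧ a n ≤ C + 1 ∧ |b n| ≤ C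

/-- The Hilbert space `ℓ²(ℤ₊)`: the coordinate with index `i : ℕ` belongs to the site
`i + 1 ∈ ℤ₊`. -/
abbrev HalfLine : Type := ℓ²(ℕ, ℂ)

/-- The sequence `u(0) = 0, u(1), u(2), …` that belongs to `u ∈ ℓ²(ℤ₊)`. -/
def site (u : ℕ → ℂ) : ℕ → ℂ
  | 0 => 0
  | i + 1 => u i

/-- The unit vector `δₙ ∈ ℓ²(ℤ₊)` of the site `n = i + 1`. -/
def delta (i : ℕ) : HalfLine := lp.single 2 i 1

/-- The spectral functional `f ↦ ⟨ψ, f(T) ψ⟩` of a bounded self-adjoint operator `T`, where `f(T)`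
is given by the continuous functional calculus. -/
def spectralFunctional {H : Type*} [NormedAddCommGroup H] [InnerProductSpace ℂ H] [CompleteSpace H]
    (T : H →L[ℂ] H) (ψ : H) : C_c(ℝ, ℝ) →ₚ[ℝ] ℝ :=
  PositiveLinearMap.mk₀
    { toFun := fun f => (inner ℂ ψ (cfc (f : ℝ → ℝ) T ψ)).re
      map_add' := fun f g => by
        have h : cfc (⇑(f + g)) T = cfc (⇑f) T + cfc (⇑g) T :=
          cfc_add (a := T) (⇑f) (⇑g) f.continuous.continuousOn g.continuous.continuousOn
        rw [h, _root_.add_apply, inner_add_right, Complex.add_re]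
      map_smul' := fun c f => by
        have h : cfc (⇑(c • f)) T = c • cfc (⇑f) T :=
          cfc_smul (a := T) c (⇑f) f.continuous.continuousOn
        rw [h, _root_.smul_apply, inner_smul_right_eq_smul]
        simp }
    (fun f hf => by
      have h : 0 ≤ cfc (⇑f) T := cfc_nonneg fun x _ => hf x
      exact ((ContinuousLinearMap.nonneg_iff_isPositive _).1 h).re_inner_nonneg_right ψ)

/-- The spectral measure `d‖E(t)ψ‖²` of a bounded self-adjoint operator `T` and a vector `ψ`, where
`E` is the spectral resolution of `T`: the Borel measure `μ` with `∫ f dμ = ⟨ψ, f(T) ψ⟩` for all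
`f ∈ C_c(ℝ)`. -/
def spectralMeasure {H : Type*} [NormedAddCommGroup H] [InnerProductSpace ℂ H] [CompleteSpace H]
    (T : H →L[ℂ] H) (ψ : H) : Measure ℝ :=
  RealRMK.rieszMeasure (spectralFunctional T ψ)

theorem memlp_two_iff_summable (u : ℕ → ℂ) : Memℓp u 2 ↔ Summable fun i => ‖u i‖ ^ 2 := by
  rw [memℓp_gen_iff (by norm_num)]
  norm_num

theorem memlp_site {u : ℕ → ℂ} (hu : Memℓp u 2) (k : ℕ) : Memℓp (fun i => site u (i + k)) 2 := by
  rw [memlp_two_iff_summable] at hu ⊢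
  exact (summable_nat_add_iff (f := fun i => ‖site u i‖ ^ 2) k).2
    ((summable_nat_add_iff (f := fun i => ‖site u i‖ ^ 2) 1).1 hu)

theorem memlp_mul {c : ℕ → ℝ} {u : ℕ → ℂ} {K : ℝ} (hc : ∀ i, |c i| ≤ K) (hu : Memℓp u 2) :
    Memℓp (fun i => (c i : ℂ) * u i) 2 := by
  rw [memlp_two_iff_summable] at hu ⊢
  refine Summable.of_nonneg_of_le (fun i => by positivity) (fun i => ?_) (hu.mul_left (K ^ 2))
  rw [norm_mul, mul_pow, Complex.norm_real, Real.norm_eq_abs]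
  gcongr
  exact hc i

namespace JacobiCoeff

variable (c : JacobiCoeff)

/-- The matrix action `(J u)(n) = a(n) u(n+1) + a(n-1) u(n-1) + b(n) u(n)` at the site
`n = i + 1`, with `u(0) = 0`. -/
def act (u : ℕ → ℂ) (i : ℕ) : ℂ :=
  c.a (i + 1) * site u (i + 2) + c.a i * site u i + c.b (i + 1) * site u (i + 1)

theorem memlp_act {u : ℕ → ℂ} (hu : Memℓp u 2) : Memℓp (c.act u) 2 := by
  obtain ⟨C, hC, h⟩ := c.bounded
  have ha : ∀ n, |c.a n| ≤ C + 1 := by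
    intro n
    rcases Nat.eq_zero_or_pos n with rfl | hn
    · rw [c.a_zero, abs_one]; linarith
    · have h1 : (0 : ℝ) < (C + 1)⁻¹ := by positivity
      rw [abs_of_pos (h1.trans_le (h n hn).1)]
      exact (h n hn).2.1
  have hb : ∀ i, |c.b (i + 1)| ≤ C := fun i => (h (i + 1) (by omega)).2.2
  exact ((memlp_mul (fun i => ha (i + 1)) (memlp_site hu 2)).add
    (memlp_mul ha (memlp_site hu 0))).add (memlp_mul hb (memlp_site hu 1))

/-- The Jacobi operator as an everywhere defined linear map on `ℓ²(ℤ₊)`. -/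
def linOp : HalfLine →ₗ[ℂ] HalfLine where
  toFun u := ⟨c.act u, c.memlp_act u.2⟩
  map_add' u v := by
    ext i
    change c.act (⇑u + ⇑v) i = c.act u i + c.act v i
    cases i <;> simp only [act, site, Pi.add_apply] <;> ring
  map_smul' r u := by
    ext i
    change c.act (r • ⇑u) i = r • c.act u i
    cases i <;> simp only [act, site, Pi.smul_apply, smul_eq_mul] <;> ring

/-- The Jacobi operator `J`, a bounded operator on `ℓ²(ℤ₊)`. -/
def op : HalfLine →L[ℂ] HalfLine :=
  ContinuousLinearMap.ofSeqClosedGraph (g := c.linOp) (by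
    intro u x y hu hJu
    have hcoord : ∀ {v : ℕ → HalfLine} {w : HalfLine}, Tendsto v atTop (𝓝 w) →
        ∀ i, Tendsto (fun k => v k i) atTop (𝓝 (w i)) := fun hv i =>
      ((lp.evalCLM ℂ (fun _ : ℕ => ℂ) 2 i).continuous.tendsto _).comp hv
    have hsite : ∀ i, Tendsto (fun k => site (u k) i) atTop (𝓝 (site x i)) := by
      intro i
      cases i with
      | zero => exact tendsto_const_nhds
      | succ i => exact hcoord hu i
    ext i
    refine tendsto_nhds_unique (hcoord hJu i) ?_
    exact (((hsite (i + 2)).const_mul _).add ((hsite i).const_mul _)).add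
      ((hsite (i + 1)).const_mul _))

/-- The Green function `⟨δₙ, (J - z)⁻¹ δₙ⟩` of the site `n = i + 1`. -/
def green (i : ℕ) (z : ℂ) : ℂ :=
  inner ℂ (delta i) (Ring.inverse (c.op - z • (1 : HalfLine →L[ℂ] HalfLine)) (delta i))

/-- The Titchmarsh-Weyl `m` function `m₊(z) = ⟨δ₁, (J - z)⁻¹ δ₁⟩`. -/
def mPlus (z : ℂ) : ℂ := c.green 0 z

/-- The solution `f` of `a(n) f(n+1) + a(n-1) f(n-1) + b(n) f(n) = z f(n)`, `n ≥ 1`, with the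
initial values `f(0) = x`, `f(1) = y`. -/
def sol (x y z : ℂ) : ℕ → ℂ
  | 0 => x
  | 1 => y
  | n + 2 => ((z - c.b (n + 1)) * sol x y z (n + 1) - c.a n * sol x y z n) / c.a (n + 1)

/-- `f₊(n, z)`: `f₊(0, z) = 1`, `f₊(1, z) = -m₊(z)`. -/
def fPlus (n : ℕ) (z : ℂ) : ℂ := c.sol 1 (-c.mPlus z) z n

/-- `f₋(n, z)`: `f₋(0, z) = 0`, `f₋(1, z) = 1`. -/
def fMinus (n : ℕ) (z : ℂ) : ℂ := c.sol 0 1 z n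

/-- `m₊(n, z) = -f₊(n+1, z) / (a(n) f₊(n, z))`. -/
def mPlusAt (n : ℕ) (z : ℂ) : ℂ := -(c.fPlus (n + 1) z / (c.a n * c.fPlus n z))

/-- `m₋(n, z) = f₋(n+1, z) / (a(n) f₋(n, z))`. -/
def mMinusAt (n : ℕ) (z : ℂ) : ℂ := c.fMinus (n + 1) z / (c.a n * c.fMinus n z)

/-- `w₊^{(N)}(z) = (1/N) ∑_{n=1}^N ln [a(n) m₊(n, z)]`; on `ℂ⁺` the principal logarithm is the one
with imaginary part in `(0, π)`. -/
def wPlusN (N : ℕ) (z : ℂ) : ℂ :=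
  (1 / N : ℂ) * ∑ n ∈ Finset.Icc 1 N, Complex.log (c.a n * c.mPlusAt n z)

/-- `w₋^{(N)}(z) = (1/N) ∑_{n=1}^N ln [a(n) m₋(n, z)]`. -/
def wMinusN (N : ℕ) (z : ℂ) : ℂ :=
  (1 / N : ℂ) * ∑ n ∈ Finset.Icc 1 N, Complex.log (c.a n * c.mMinusAt n z)

/-- `g_N(z) = (1/N) ∑_{n=1}^N ⟨δₙ, (J - z)⁻¹ δₙ⟩`. -/
def gN (N : ℕ) (z : ℂ) : ℂ := (1 / N : ℂ) * ∑ i ∈ Finset.range N, c.green i z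

/-- `dν_N(t) = (1/N) ∑_{n=1}^N d‖E(t) δₙ‖²`. -/
def nuN (N : ℕ) : Measure ℝ :=
  (N : ℝ≥0∞)⁻¹ • ∑ i ∈ Finset.range N, spectralMeasure c.op (delta i)

/-- The restriction `J_N` of `J` to `ℓ²({1, …, N})` with boundary conditions
`u(0) = u(N+1) = 0`. The index `i : Fin N` belongs to the site `i + 1`. -/
def truncation (N : ℕ) : Matrix (Fin N) (Fin N) ℝ := fun i j =>
  if (i : ℕ) = j then c.b (i + 1)
  else if (j : ℕ) = i + 1 then c.a (i + 1)
  else if (i : ℕ) = j + 1 then c.a (j + 1)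
  else 0

theorem truncation_isHermitian (N : ℕ) : (c.truncation N).IsHermitian := by
  refine Matrix.IsHermitian.ext fun i j => ?_
  simp only [truncation, star_trivial]
  split_ifs <;> first | omega | simp_all

/-- `dk_N = (1/N) ∑_{n=1}^N δ_{λₙ}`, where `λ₁, …, λ_N` are the eigenvalues of `J_N`. -/
def kN (N : ℕ) : Measure ℝ :=
  (N : ℝ≥0∞)⁻¹ • ∑ i : Fin N, Measure.dirac ((c.truncation_isHermitian N).eigenvalues i)

end JacobiCoeff

/-- Uniform convergence on compact subsets of `ℂ⁺`. -/
def TendstoOnCompacts (F : ℕ → ℂ → ℂ) (G : ℂ → ℂ) : Prop :=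
  ∀ K ⊆ upperHalf, IsCompact K → TendstoUniformlyOn F G atTop K

/-- Weak-* convergence of Borel measures on `ℝ`, tested against continuous functions of compact
support. -/
def TendstoWeakStar (μ : ℕ → Measure ℝ) (ν : Measure ℝ) : Prop :=
  ∀ f : ℝ → ℝ, Continuous f → HasCompactSupport f →
    Tendsto (fun j => ∫ t, f t ∂(μ j)) atTop (𝓝 (∫ t, f t ∂ν))

end

noncomputable section

/-! Everything is read off from `f₊` and `f₋`. The Wronskian of the two is `-1`, so the Green
function at site `n` is `-f₊(n) f₋(n)` (`green_eq`). Hence the product of `a(n) m₊(n)` and `a(n)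
m₋(n)` is minus a quotient of consecutive Green functions. Taking logarithms (`log_add_log`) and
telescoping gives `w₊ + w₋ = iπ` in the limit, because the logarithm of the Green function is
bounded uniformly in the site (`exists_norm_log_green_le`).

The derivative of `w₋^{(N)}` is `1/N` times the logarithmic derivative of `f₋(N+1)`. A summed Green
identity (`sum_fPlus_mul_fMinus`) shows that the sum of the first `N` Green functions is minus that
logarithmic derivative up to an error bounded in `N` (`exists_norm_green_sum_add_deriv_le`). Hence
`g = -w₋' = w₊'`. Decay of `f₊` gives `Re w₊ ≤ 0`, and `Im w₊' > 0` makes this strict, so `-i w₊` is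
Herglotz.

Up to the factor `a(1)⋯a(N)`, `f₋(N+1)` is the characteristic polynomial of the truncation
(`charpoly_truncation_eval`). Therefore `Re w₋` is the real part of the logarithmic potential of the
limit of `k_N`, minus `ln A`. It follows that `w₊ = ln A - ∫ ln(t - z)` up to an imaginary constant.
The boundary values of `Im w₊` lie in `[0, π]` and grow by exactly `π` across the support, which
forces the constant to be `0`. These boundary values are `π` times the midpoint distribution
function, which identifies `dk`. Finally `ν` has Stieltjes transform `g`, hence coincides with this
measure (`eq_of_stieltjes_eq`). -/

theorem isOpen_upperHalf : IsOpen upperHalf := isOpen_lt continuous_const continuous_im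

theorem isPreconnected_upperHalf : IsPreconnected upperHalf :=
  (convex_halfSpace_im_gt 0).isPreconnected

/-! ### Weak-* limits with bounded support -/

/-- A continuous cutoff function, equal to `1` on `[-M, M]` and to `0` off `[-M - 1, M + 1]`. -/
def cutoff (M t : ℝ) : ℝ := max 0 (min 1 (M + 1 - |t|))

theorem continuous_cutoff (M : ℝ) : Continuous (cutoff M) := by
  unfold cutoff; fun_prop

theorem cutoff_eq_one {M t : ℝ} (h : |t| ≤ M) : cutoff M t = 1 := by
  unfold cutoff
  rw [min_eq_left (by linarith), max_eq_right zero_le_one]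

theorem hasCompactSupport_cutoff (M : ℝ) : HasCompactSupport (cutoff M) := by
  refine HasCompactSupport.intro (isCompact_Icc (a := -(M + 1)) (b := M + 1)) fun t ht => ?_
  have : M + 1 ≤ |t| := by
    by_contra! h
    exact ht ⟨by linarith [(abs_lt.1 h).1], by linarith [(abs_lt.1 h).2]⟩
  unfold cutoff
  exact max_eq_left ((min_le_right _ _).trans (by linarith))

/-- A weak-* limit of measures supported in `[-M, M]` is supported in `[-M, M]`. -/
theorem TendstoWeakStar.ae_abs_le {μ : ℕ → Measure ℝ} {ν : Measure ℝ} [IsFiniteMeasure ν]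
    (h : TendstoWeakStar μ ν) {M : ℝ}
    (hM : ∀ f : ℝ → ℝ, Continuous f → HasCompactSupport f → (∀ t, |t| ≤ M → f t = 0) →
      ∀ j, ∫ t, f t ∂(μ j) = 0) : ∀ᵐ t ∂ν, |t| ≤ M := by
  have key : ∀ R : ℕ, ∀ᵐ t ∂ν, ¬ (M < |t| ∧ |t| < R) := by
    intro R
    set f : ℝ → ℝ := fun t => max 0 (min (|t| - M) (R - |t|)) with hf
    have hc : Continuous f := by fun_prop
    have hs : HasCompactSupport f := by
      refine HasCompactSupport.intro (isCompact_Icc (a := -(R : ℝ)) (b := R)) fun t ht => ?_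
      have : (R : ℝ) ≤ |t| := by
        by_contra! h
        exact ht ⟨by linarith [(abs_lt.1 h).1], by linarith [(abs_lt.1 h).2]⟩
      exact max_eq_left ((min_le_right _ _).trans (by linarith))
    have h0 : ∫ t, f t ∂ν = 0 := by
      refine tendsto_nhds_unique (h f hc hs) ?_
      simp only [hM f hc hs fun t ht => max_eq_left ((min_le_left _ _).trans (by linarith))]
      exact tendsto_const_nhds
    rw [integral_eq_zero_iff_of_nonneg (f := f) (fun t => le_max_left _ _)
      (hc.integrable_of_hasCompactSupport hs)] at h0
    filter_upwards [h0] with t ht hlt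
    have : 0 < f t := lt_max_of_lt_right (lt_min (by linarith [hlt.1]) (by linarith [hlt.2]))
    exact this.ne' ht
  filter_upwards [ae_all_iff.2 key] with t ht
  by_contra! hlt
  obtain ⟨R, hR⟩ := exists_nat_gt |t|
  exact ht R ⟨hlt, hR⟩

/-- Test functions without compact support are allowed once they are cut off off the support. -/
theorem TendstoWeakStar.tendsto_cutoff {μ : ℕ → Measure ℝ} {ν : Measure ℝ}
    (h : TendstoWeakStar μ ν) {M : ℝ} (hM : ∀ᵐ t ∂ν, |t| ≤ M) {φ : ℝ → ℝ} (hφ : Continuous φ) :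
    Tendsto (fun j => ∫ t, cutoff M t * φ t ∂(μ j)) atTop (𝓝 (∫ t, φ t ∂ν)) := by
  have h1 := h (fun t => cutoff M t * φ t) ((continuous_cutoff M).mul hφ)
    (hasCompactSupport_cutoff M).mul_right
  convert h1 using 2
  refine integral_congr_ae ?_
  filter_upwards [hM] with t ht
  rw [cutoff_eq_one ht, one_mul]

theorem integrable_of_ae_abs_le {E : Type*} [NormedAddCommGroup E] {μ : Measure ℝ}
    [IsFiniteMeasure μ] {M : ℝ} (hM : ∀ᵐ t ∂μ, |t| ≤ M) {φ : ℝ → E} (hφ : Continuous φ) :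
    Integrable φ μ := by
  have h1 : IntegrableOn φ (Set.Icc (-M) M) μ := hφ.continuousOn.integrableOn_compact isCompact_Icc
  rwa [IntegrableOn, Measure.restrict_eq_self_of_ae_mem] at h1
  filter_upwards [hM] with t ht using abs_le.1 ht

theorem ofReal_sub_ne_zero {z : ℂ} (hz : z ∈ upperHalf) (t : ℝ) : (t : ℂ) - z ≠ 0 := by
  intro h
  have := congrArg im h
  simp at this
  exact (ne_of_gt hz) this

theorem ofReal_sub_mem_slitPlane {z : ℂ} (hz : z ∈ upperHalf) (t : ℝ) :
    (t : ℂ) - z ∈ slitPlane := by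
  rw [mem_slitPlane_iff]
  right
  simpa using (ne_of_gt hz)

theorem continuous_log_sub {z : ℂ} (hz : z ∈ upperHalf) :
    Continuous fun t : ℝ => Complex.log ((t : ℂ) - z) :=
  Continuous.clog (by fun_prop) (ofReal_sub_mem_slitPlane hz)

theorem continuous_inv_sub {z : ℂ} (hz : z ∈ upperHalf) :
    Continuous fun t : ℝ => 1 / ((t : ℂ) - z) :=
  continuous_const.div (by fun_prop) (ofReal_sub_ne_zero hz)

/-! ### Logarithmic potentials and their boundary values -/

/-- The logarithmic potential `z ↦ ∫ ln (t - z) dμ(t)`. -/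
def logPotential (μ : Measure ℝ) (z : ℂ) : ℂ := ∫ t : ℝ, Complex.log ((t : ℂ) - z) ∂μ

/-- Differentiation under the integral sign. On the disc of radius `Im z / 2` the imaginary part
stays above `Im z / 2`, so `2 / Im z` dominates the differentiated integrand. -/
theorem hasDerivAt_logPotential {μ : Measure ℝ} [IsFiniteMeasure μ] {M : ℝ}
    (hM : ∀ᵐ t ∂μ, |t| ≤ M) {z : ℂ} (hz : z ∈ upperHalf) :
    HasDerivAt (logPotential μ) (-∫ t : ℝ, 1 / ((t : ℂ) - z) ∂μ) z := by
  have hz' : 0 < z.im := hz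
  have hb : ∀ w ∈ Metric.ball z (z.im / 2), z.im / 2 < w.im := by
    intro w hw
    have h1 := (Complex.abs_im_le_norm (w - z)).trans_lt (mem_ball_iff_norm.1 hw)
    rw [sub_im] at h1
    linarith [(abs_lt.1 h1).1]
  have hU : ∀ w ∈ Metric.ball z (z.im / 2), w ∈ upperHalf := fun w hw =>
    lt_trans (half_pos hz') (hb w hw)
  have := (hasDerivAt_integral_of_dominated_loc_of_deriv_le (μ := μ) (x₀ := z)
    (F := fun w t => Complex.log ((t : ℂ) - w)) (F' := fun w t => -(1 / ((t : ℂ) - w)))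
    (bound := fun _ => 2 / z.im) (Metric.ball_mem_nhds z (half_pos hz'))
    (by
      filter_upwards [Metric.ball_mem_nhds z (half_pos hz')] with w hw
      exact (continuous_log_sub (hU w hw)).aestronglyMeasurable)
    (integrable_of_ae_abs_le hM (continuous_log_sub hz))
    ((continuous_inv_sub hz).neg.aestronglyMeasurable)
    (by
      refine Eventually.of_forall fun t w hw => ?_
      rw [norm_neg, norm_div, norm_one, one_div, inv_le_comm₀, inv_div]
      · have h1 := Complex.abs_im_le_norm ((t : ℂ) - w)
        have h2 := hb w hw
        simp only [sub_im, ofReal_im, zero_sub, abs_neg] at h1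
        exact (h2.le.trans (le_abs_self _)).trans h1
      · exact norm_pos_iff.2 (ofReal_sub_ne_zero (hU w hw) t)
      · positivity)
    (integrable_const _)
    (by
      refine Eventually.of_forall fun t w hw => ?_
      have := ((hasDerivAt_id w).const_sub (t : ℂ)).clog (ofReal_sub_mem_slitPlane (hU w hw) t)
      simpa [neg_div] using this)).2
  rwa [integral_neg] at this

/-- The distribution function of `μ`, normalized to the mean value at jumps. -/
def midCdf (μ : Measure ℝ) (x : ℝ) : ℝ := (μ.real (Set.Iio x) + μ.real (Set.Iic x)) / 2

theorem monotone_midCdf (μ : Measure ℝ) [IsFiniteMeasure μ] : Monotone (midCdf μ) := by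
  intro x y h
  unfold midCdf
  have h1 := measureReal_mono (μ := μ) (Set.Iio_subset_Iio h)
  have h2 := measureReal_mono (μ := μ) (Set.Iic_subset_Iic.2 h)
  linarith

theorem midCdf_eq_zero {μ : Measure ℝ} [IsFiniteMeasure μ] {M : ℝ} (hM : ∀ᵐ t ∂μ, |t| ≤ M)
    {x : ℝ} (hx : x < -M) : midCdf μ x = 0 := by
  have h : μ.real (Set.Iic x) = 0 := by
    rw [measureReal_eq_zero_iff]
    refine measure_mono_null (fun t ht => ?_) (ae_iff.1 hM)
    have ht' : t ≤ x := ht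
    intro h
    linarith [(abs_le.1 h).1]
  have h2 : μ.real (Set.Iio x) = 0 :=
    le_antisymm ((measureReal_mono Set.Iio_subset_Iic_self).trans h.le) measureReal_nonneg
  rw [midCdf, h, h2]; norm_num

theorem midCdf_eq_one {μ : Measure ℝ} [IsProbabilityMeasure μ] {M : ℝ} (hM : ∀ᵐ t ∂μ, |t| ≤ M)
    {x : ℝ} (hx : M < x) : midCdf μ x = 1 := by
  have h2 : μ.real (Set.Iio x) = 1 := by
    rw [measureReal_def, prob_compl_eq_zero_iff measurableSet_Iio |>.1, ENNReal.toReal_one]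
    refine measure_mono_null (fun t ht => ?_) (ae_iff.1 hM)
    have ht' : x ≤ t := not_lt.1 ht
    intro h
    linarith [(abs_le.1 h).2]
  have h : μ.real (Set.Iic x) = 1 :=
    le_antisymm measureReal_le_one (h2.ge.trans (measureReal_mono Set.Iio_subset_Iic_self))
  rw [midCdf, h, h2]; norm_num

/-- Passing to right limits turns the midpoint value at a jump into the full one, so the ordinary
distribution function appears. The function `κ` is kept separate from `μ` so that one function can
be matched with two measures. -/
theorem stieltjesFunction_midCdf_measure (μ : Measure ℝ) [IsProbabilityMeasure μ]
    {κ : ℝ → ℝ} (hκ : Monotone κ) (h : κ = midCdf μ) : hκ.stieltjesFunction.measure = μ := by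
  subst h
  have : hκ.stieltjesFunction = ProbabilityTheory.cdf μ := by
    ext x
    rw [hκ.stieltjesFunction_eq]
    refine rightLim_eq_of_tendsto ?_
    have hc : Tendsto (ProbabilityTheory.cdf μ) (𝓝[>] x) (𝓝 (ProbabilityTheory.cdf μ x)) :=
      ((ProbabilityTheory.cdf μ).right_continuous x).mono_left
        (nhdsWithin_mono _ Set.Ioi_subset_Ici_self)
    refine tendsto_of_tendsto_of_tendsto_of_le_of_le' tendsto_const_nhds hc ?_ ?_
    · filter_upwards [self_mem_nhdsWithin] with y hy
      rw [ProbabilityTheory.cdf_eq_real, midCdf]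
      have h1 := measureReal_mono (μ := μ) (Set.Iic_subset_Iio.2 hy)
      have h2 := measureReal_mono (μ := μ) (Set.Iio_subset_Iic_self (a := y))
      linarith
    · filter_upwards with y
      rw [ProbabilityTheory.cdf_eq_real, midCdf]
      have h2 := measureReal_mono (μ := μ) (Set.Iio_subset_Iic_self (a := y))
      linarith
  rw [this, ProbabilityTheory.measure_cdf]

/-- The point `t - x` is approached from below, so the argument tends to `-π`, `-π/2` or `0`
according to the sign of `t - x`. The two indicators encode the three cases, and the middle one
produces the midpoint normalization. -/
theorem tendsto_arg_sub (x t : ℝ) :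
    Tendsto (fun y : ℝ => (Complex.log ((t : ℂ) - (x + y * I))).im) (𝓝[>] 0)
      (𝓝 (-(Real.pi / 2) * ((Set.Iio x).indicator 1 t + (Set.Iic x).indicator 1 t))) := by
  simp only [log_im]
  have hc : Tendsto (fun y : ℝ => (t : ℂ) - (x + y * I)) (𝓝[>] 0) (𝓝 ((t : ℂ) - x)) := by
    have : Continuous fun y : ℝ => (t : ℂ) - (x + y * I) := by fun_prop
    simpa using (this.tendsto 0).mono_left nhdsWithin_le_nhds
  rcases lt_trichotomy t x with h | h | h
  · rw [Set.indicator_of_mem (show t ∈ Set.Iio x from h),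
      Set.indicator_of_mem (show t ∈ Set.Iic x from h.le)]
    have h1 : Tendsto arg (𝓝[{z : ℂ | z.im < 0}] ((t : ℂ) - x)) (𝓝 (-Real.pi)) :=
      tendsto_arg_nhdsWithin_im_neg_of_re_neg_of_im_zero (by simpa using h) (by simp)
    have h2 := h1.comp (tendsto_nhdsWithin_iff.2 ⟨hc, by
      filter_upwards [self_mem_nhdsWithin] with y hy
      simpa using hy⟩)
    have e : -(Real.pi / 2) * ((1 : ℝ → ℝ) t + (1 : ℝ → ℝ) t) = -Real.pi := by
      simp only [Pi.one_apply]; ring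
    rw [e]
    exact h2
  · subst h
    rw [Set.indicator_of_notMem (show t ∉ Set.Iio t from lt_irrefl t),
      Set.indicator_of_mem (show t ∈ Set.Iic t from le_refl t)]
    refine tendsto_const_nhds.congr' ?_
    filter_upwards [self_mem_nhdsWithin] with y hy
    have : (t : ℂ) - (t + y * I) = (y : ℂ) * (-I) := by ring
    rw [this, arg_real_mul _ hy, arg_neg_I]
    simp only [Pi.one_apply]; ring
  · rw [Set.indicator_of_notMem (show t ∉ Set.Iio x from not_lt.2 h.le),
      Set.indicator_of_notMem (show t ∉ Set.Iic x from not_le.2 h)]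
    have h0 : ((t : ℂ) - x) = ((t - x : ℝ) : ℂ) := by push_cast; ring
    have h1 : ContinuousAt arg ((t : ℂ) - x) := continuousAt_arg (by
      rw [h0]; exact ofReal_mem_slitPlane.2 (sub_pos.2 h))
    have h2 := h1.tendsto.comp hc
    rw [h0, arg_ofReal_of_nonneg (sub_pos.2 h).le] at h2
    rw [add_zero, mul_zero]
    exact h2

theorem ofReal_add_mul_I_mem {x y : ℝ} (hy : 0 < y) : (x + y * I : ℂ) ∈ upperHalf := by
  simpa [upperHalf] using hy

/-- Boundary values of the imaginary part of the logarithmic potential. -/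
theorem tendsto_logPotential_im {μ : Measure ℝ} [IsFiniteMeasure μ] {M : ℝ}
    (hM : ∀ᵐ t ∂μ, |t| ≤ M) (x : ℝ) :
    Tendsto (fun y : ℝ => (logPotential μ (x + y * I)).im) (𝓝[>] 0)
      (𝓝 (-(Real.pi * midCdf μ x))) := by
  have h1 := tendsto_integral_filter_of_dominated_convergence (μ := μ) (l := 𝓝[>] (0 : ℝ))
    (F := fun (y : ℝ) (t : ℝ) => (Complex.log ((t : ℂ) - (x + y * I))).im)
    (f := fun t => -(Real.pi / 2) * ((Set.Iio x).indicator 1 t + (Set.Iic x).indicator 1 t))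
    (fun _ => Real.pi)
    (by
      filter_upwards [self_mem_nhdsWithin] with y hy
      exact (continuous_im.comp
        (continuous_log_sub (ofReal_add_mul_I_mem hy))).aestronglyMeasurable)
    (Eventually.of_forall fun y => Eventually.of_forall fun t => by
      rw [Real.norm_eq_abs, log_im]; exact abs_arg_le_pi _)
    (integrable_const _) (Eventually.of_forall fun t => tendsto_arg_sub x t)
  have h2 : ∫ t, -(Real.pi / 2) * ((Set.Iio x).indicator 1 t + (Set.Iic x).indicator 1 t) ∂μ
      = -(Real.pi * midCdf μ x) := by
    rw [integral_const_mul, integral_add, integral_indicator_one measurableSet_Iio,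
      integral_indicator_one measurableSet_Iic, midCdf]
    · ring
    · exact (integrable_const (1 : ℝ)).indicator measurableSet_Iio
    · exact (integrable_const (1 : ℝ)).indicator measurableSet_Iic
  rw [h2] at h1
  refine h1.congr' ?_
  filter_upwards [self_mem_nhdsWithin] with y hy
  exact integral_im (integrable_of_ae_abs_le hM (continuous_log_sub (ofReal_add_mul_I_mem hy)))

/-- A compactly supported probability measure is determined by its Stieltjes transform. -/
theorem eq_of_stieltjes_eq {μ ν : Measure ℝ} [IsProbabilityMeasure μ] [IsProbabilityMeasure ν]
    {M : ℝ} (hμ : ∀ᵐ t ∂μ, |t| ≤ M) (hν : ∀ᵐ t ∂ν, |t| ≤ M)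
    (h : ∀ z ∈ upperHalf, ∫ t : ℝ, 1 / ((t : ℂ) - z) ∂μ = ∫ t : ℝ, 1 / ((t : ℂ) - z) ∂ν) :
    μ = ν := by
  have hd : ∀ z ∈ upperHalf,
      HasDerivAt (fun z => logPotential μ z - logPotential ν z) 0 z := by
    intro z hz
    have := (hasDerivAt_logPotential hμ hz).sub (hasDerivAt_logPotential hν hz)
    rwa [h z hz, sub_self] at this
  have hI : (I : ℂ) ∈ upperHalf := by simp [upperHalf]
  have hconst : ∀ z ∈ upperHalf,
      logPotential μ z - logPotential ν z = logPotential μ I - logPotential ν I := fun z hz =>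
    isOpen_upperHalf.is_const_of_deriv_eq_zero isPreconnected_upperHalf
      (fun z hz => (hd z hz).differentiableAt.differentiableWithinAt)
      (fun z hz => (hd z hz).deriv) hz hI
  set d := (logPotential μ I - logPotential ν I).im
  have hmid : ∀ x, -(Real.pi * midCdf μ x) - -(Real.pi * midCdf ν x) = d := by
    intro x
    refine tendsto_nhds_unique
      ((tendsto_logPotential_im hμ x).sub (tendsto_logPotential_im hν x)) ?_
    refine tendsto_const_nhds.congr' ?_
    filter_upwards [self_mem_nhdsWithin] with y hy
    rw [← sub_im, hconst _ (ofReal_add_mul_I_mem hy)]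
  -- To the left of both supports the two distribution functions vanish.
  have hd0 : d = 0 := by
    rw [← hmid (-M - 1), midCdf_eq_zero hμ (by linarith), midCdf_eq_zero hν (by linarith)]; simp
  have heq : midCdf μ = midCdf ν := by
    ext x
    have := hmid x
    rw [hd0] at this
    have hpi := Real.pi_pos
    nlinarith
  rw [← stieltjesFunction_midCdf_measure μ (monotone_midCdf μ) rfl,
    stieltjesFunction_midCdf_measure ν (monotone_midCdf μ) heq]

/-! ### Resolvent, Weyl solution and Green function -/

namespace JacobiCoeff

variable (c : JacobiCoeff)

theorem op_apply (u : HalfLine) (i : ℕ) : c.op u i = c.act u i := rfl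

theorem inner_delta (i : ℕ) (u : HalfLine) : inner ℂ (delta i) u = u i := by
  rw [delta, lp.inner_single_left]
  simp

theorem delta_apply (i j : ℕ) : delta i j = if j = i then 1 else 0 := by
  rw [delta, lp.single_apply, Pi.single_apply]

theorem op_delta_zero : c.op (delta 0) = (c.a 1 : ℂ) • delta 1 + (c.b 1 : ℂ) • delta 0 := by
  ext k
  rw [op_apply]
  simp only [act, site, delta_apply, lp.coeFn_add, lp.coeFn_smul, Pi.add_apply, Pi.smul_apply,
    smul_eq_mul]
  rcases k with _ | _ | k <;> simp

theorem op_delta_succ (i : ℕ) : c.op (delta (i + 1)) =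
    (c.a (i + 2) : ℂ) • delta (i + 2) + (c.a (i + 1) : ℂ) • delta i
      + (c.b (i + 2) : ℂ) • delta (i + 1) := by
  ext k
  rw [op_apply]
  rcases k with _ | k
  · simp only [act, site, delta_apply, lp.coeFn_add, lp.coeFn_smul, Pi.add_apply, Pi.smul_apply,
      smul_eq_mul]
    rcases i with _ | i <;> simp
  · simp only [act, site, delta_apply, lp.coeFn_add, lp.coeFn_smul, Pi.add_apply, Pi.smul_apply,
      smul_eq_mul]
    rcases lt_trichotomy k i with h | h | h
    · by_cases h1 : i = k + 1
      · subst h1; simp; omega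
      · have h2 : k ≠ i := by omega
        have h3 : k ≠ i + 1 := by omega
        have h4 : k + 1 ≠ i := by omega
        simp [h2, h3, h4]
    · subst h; simp
    · by_cases h1 : k = i + 1
      · subst h1
        simp only [Nat.reduceEqDiff, if_true]
        simp
        intro h1
        omega
      · have h2 : k ≠ i := by omega
        have h4 : k + 1 ≠ i := by omega
        simp [h1, h2, h4]

theorem op_isSelfAdjoint : IsSelfAdjoint c.op := by
  rw [ContinuousLinearMap.isSelfAdjoint_iff']
  ext u i
  rw [← inner_delta i, ContinuousLinearMap.adjoint_inner_right, op_apply]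
  rcases i with _ | i
  · rw [op_delta_zero, inner_add_left, inner_smul_left, inner_smul_left, inner_delta, inner_delta]
    simp [act, site]
  · rw [op_delta_succ, inner_add_left, inner_add_left, inner_smul_left, inner_smul_left,
      inner_smul_left, inner_delta, inner_delta, inner_delta]
    simp [act, site]

theorem isUnit_op_sub {z : ℂ} (hz : z ∈ upperHalf) :
    IsUnit (c.op - z • (1 : HalfLine →L[ℂ] HalfLine)) := by
  have h : z ∉ spectrum ℂ c.op := by
    intro h
    have h1 := congrArg im (c.op_isSelfAdjoint.mem_spectrum_eq_re h)
    rw [ofReal_im] at h1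
    exact (ne_of_gt hz) h1
  rw [spectrum.notMem_iff, Algebra.algebraMap_eq_smul_one, ← IsUnit.neg_iff, neg_sub] at h
  exact h

theorem inverse_apply_eq {z : ℂ} (hz : z ∈ upperHalf) {v w : HalfLine}
    (h : c.op v - z • v = w) :
    Ring.inverse (c.op - z • (1 : HalfLine →L[ℂ] HalfLine)) w = v := by
  have h1 := congrArg (fun T : HalfLine →L[ℂ] HalfLine => T v)
    (Ring.inverse_mul_cancel _ (c.isUnit_op_sub hz))
  simpa [← h] using h1

theorem op_inverse_apply {z : ℂ} (hz : z ∈ upperHalf) (w : HalfLine) :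
    c.op (Ring.inverse (c.op - z • (1 : HalfLine →L[ℂ] HalfLine)) w)
      - z • Ring.inverse (c.op - z • (1 : HalfLine →L[ℂ] HalfLine)) w = w := by
  have h1 := congrArg (fun T : HalfLine →L[ℂ] HalfLine => T w)
    (Ring.mul_inverse_cancel _ (c.isUnit_op_sub hz))
  simpa using h1

theorem a_pos (n : ℕ) : 0 < c.a n := by
  rcases Nat.eq_zero_or_pos n with rfl | hn
  · rw [c.a_zero]; exact one_pos
  · obtain ⟨C, hC, h⟩ := c.bounded
    exact lt_of_lt_of_le (by positivity) (h n hn).1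

theorem a_ne_zero (n : ℕ) : (c.a n : ℂ) ≠ 0 := ofReal_ne_zero.2 (c.a_pos n).ne'

theorem sol_recurrence (x y z : ℂ) (n : ℕ) :
    c.a (n + 1) * c.sol x y z (n + 2) + c.a n * c.sol x y z n
      = (z - c.b (n + 1)) * c.sol x y z (n + 1) := by
  rw [sol, mul_div_cancel₀ _ (c.a_ne_zero (n + 1))]
  ring

theorem sol_unique {x y z : ℂ} {u : ℕ → ℂ} (h0 : u 0 = x) (h1 : u 1 = y)
    (h : ∀ n, c.a (n + 1) * u (n + 2) + c.a n * u n = (z - c.b (n + 1)) * u (n + 1)) (n : ℕ) :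
    c.sol x y z n = u n := by
  induction n using Nat.twoStepInduction with
  | zero => rw [sol, h0]
  | one => rw [sol, h1]
  | more n ih1 ih2 =>
    rw [sol, ih1, ih2, div_eq_iff (c.a_ne_zero _), ← h n]
    ring

/-- `f₊` is, up to sign, the first column of the resolvent. -/
theorem fPlus_succ {z : ℂ} (hz : z ∈ upperHalf) (i : ℕ) :
    c.fPlus (i + 1) z =
      -(Ring.inverse (c.op - z • (1 : HalfLine →L[ℂ] HalfLine)) (delta 0)) i := by
  set u := Ring.inverse (c.op - z • (1 : HalfLine →L[ℂ] HalfLine)) (delta 0) with hu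
  have hJ : ∀ i, c.act u i - z * u i = delta 0 i := fun i => by
    rw [← c.op_inverse_apply hz (delta 0), ← hu]
    rfl
  -- The value `1` at site `0`, together with `a 0 = 1`, absorbs the source `δ₁` of the resolvent
  -- equation.
  let v : ℕ → ℂ := fun n => Nat.casesOn n 1 fun i => -u i
  have v_zero : v 0 = 1 := rfl
  have v_succ : ∀ n, v (n + 1) = -u n := fun _ => rfl
  refine c.sol_unique (u := v) rfl ?_ ?_ (i + 1)
  · change -u 0 = -c.mPlus z
    rw [mPlus, green, inner_delta]
  · intro n
    have h1 := hJ n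
    rcases n with _ | n
    · simp only [act, site, delta_apply, if_true] at h1
      have v_one : v 1 = -u 0 := rfl
      rw [zero_add, v_zero, v_succ 1, v_one]
      simp only [zero_add, c.a_zero, ofReal_one] at h1 ⊢
      linear_combination -h1
    · simp only [act, site, delta_apply, Nat.add_one_ne_zero, if_false] at h1
      rw [v_succ, v_succ, v_succ]
      linear_combination -h1

theorem memlp_fPlus {z : ℂ} (hz : z ∈ upperHalf) : Memℓp (fun i => c.fPlus (i + 1) z) 2 := by
  have h := (Ring.inverse (c.op - z • (1 : HalfLine →L[ℂ] HalfLine)) (delta 0)).2.neg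
  convert h using 1
  ext i
  rw [c.fPlus_succ hz]
  rfl

theorem tendsto_fPlus {z : ℂ} (hz : z ∈ upperHalf) :
    Tendsto (fun n => c.fPlus n z) atTop (𝓝 0) := by
  rw [← tendsto_add_atTop_iff_nat 1]
  have h := ((memlp_two_iff_summable _).1 (c.memlp_fPlus hz)).tendsto_atTop_zero
  rw [tendsto_zero_iff_norm_tendsto_zero]
  have h2 := (Real.continuous_sqrt.tendsto 0).comp h
  rw [Real.sqrt_zero] at h2
  refine h2.congr fun n => ?_
  simp [Real.sqrt_sq]

theorem wronskian (z : ℂ) (n : ℕ) :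
    c.a n * (c.fPlus (n + 1) z * c.fMinus n z - c.fPlus n z * c.fMinus (n + 1) z) = -1 := by
  induction n with
  | zero => simp [fPlus, fMinus, sol, c.a_zero]
  | succ n ih =>
    have h1 := c.sol_recurrence 1 (-c.mPlus z) z n
    have h2 := c.sol_recurrence 0 1 z n
    simp only [fPlus, fMinus] at ih ⊢
    linear_combination ih + c.sol 0 1 z (n + 1) * h1 - c.sol 1 (-c.mPlus z) z (n + 1) * h2

/-- Variation of constants: the resolvent column follows `f₋` up to the diagonal and `f₊` beyond it,
and the Wronskian produces the unit source. Square summability of `f₊` puts it in the Hilbert space.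
-/
theorem green_eq {z : ℂ} (hz : z ∈ upperHalf) (i : ℕ) :
    c.green i z = -(c.fPlus (i + 1) z * c.fMinus (i + 1) z) := by
  let v : ℕ → ℂ := fun k => if k ≤ i then -(c.fPlus (i + 1) z * c.fMinus (k + 1) z)
    else -(c.fMinus (i + 1) z * c.fPlus (k + 1) z)
  have hsite : ∀ k, k ≤ i + 1 → site v k = -(c.fPlus (i + 1) z * c.fMinus k z) := by
    intro k hk
    rcases k with _ | k
    · simp [site, fMinus, sol]
    · simp only [site, v, if_pos (Nat.le_of_succ_le_succ hk)]
  -- Both formulas hold at the site `i + 1`, so the three-term relation can be checked with either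
  -- one on each side.
  have hsite' : ∀ k, i + 1 ≤ k → site v k = -(c.fMinus (i + 1) z * c.fPlus k z) := by
    intro k hk
    rcases eq_or_lt_of_le hk with rfl | h
    · rw [hsite _ le_rfl, mul_comm]
    · rcases k with _ | k
      · omega
      · simp only [site, v, if_neg (by omega : ¬ k ≤ i)]
  have hv : Memℓp v 2 := by
    rw [memlp_two_iff_summable, ← summable_nat_add_iff (i + 1)]
    have h1 := (memlp_two_iff_summable _).1 (c.memlp_fPlus hz)
    rw [← summable_nat_add_iff (i + 1)] at h1
    refine (h1.mul_left (‖c.fMinus (i + 1) z‖ ^ 2)).congr fun k => ?_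
    simp only [v, if_neg (by omega : ¬ k + (i + 1) ≤ i)]
    rw [norm_neg, norm_mul, mul_pow]
  have hJ : c.op (⟨v, hv⟩ : HalfLine) - z • (⟨v, hv⟩ : HalfLine) = delta i := by
    ext k
    change c.act v k - z * site v (k + 1) = delta i k
    have hp := c.sol_recurrence 0 1 z k
    have hf := c.sol_recurrence 1 (-c.mPlus z) z k
    change c.a (k + 1) * c.fMinus (k + 2) z + c.a k * c.fMinus k z
      = (z - c.b (k + 1)) * c.fMinus (k + 1) z at hp
    change c.a (k + 1) * c.fPlus (k + 2) z + c.a k * c.fPlus k z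
      = (z - c.b (k + 1)) * c.fPlus (k + 1) z at hf
    rw [act, delta_apply]
    rcases lt_trichotomy k i with h | rfl | h
    · rw [hsite k (by omega), hsite (k + 1) (by omega), hsite (k + 2) (by omega), if_neg h.ne]
      linear_combination -c.fPlus (i + 1) z * hp
    · rw [hsite k (by omega), hsite (k + 1) (by omega), hsite' (k + 2) (by omega), if_pos rfl]
      linear_combination -c.fPlus (k + 1) z * hp - c.wronskian z (k + 1)
    · rw [hsite' k (by omega), hsite' (k + 1) (by omega), hsite' (k + 2) (by omega), if_neg h.ne']
      linear_combination -c.fMinus (i + 1) z * hf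
  rw [green, inner_delta, c.inverse_apply_eq hz hJ]
  change site v (i + 1) = _
  exact hsite _ le_rfl

/-- Flux identity for solutions. -/
theorem sol_flux (x y z : ℂ) (n : ℕ) :
    c.a (n + 1) * (c.sol x y z (n + 2) * (starRingEnd ℂ) (c.sol x y z (n + 1))).im
      = c.a n * (c.sol x y z (n + 1) * (starRingEnd ℂ) (c.sol x y z n)).im
        + z.im * normSq (c.sol x y z (n + 1)) := by
  have h := c.sol_recurrence x y z n
  have h2 := congrArg im
    (congrArg (fun w => w * (starRingEnd ℂ) (c.sol x y z (n + 1))) h)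
  simp only [mul_im, add_re, add_im, mul_re, sub_re, sub_im, ofReal_re, ofReal_im, conj_re, conj_im,
    normSq_apply] at h2 ⊢
  linear_combination h2

theorem div_im_eq (x y : ℂ) : (x / y).im = (x * (starRingEnd ℂ) y).im / normSq y := by
  rw [div_im, mul_im, conj_re, conj_im]
  ring

/-- The flux of `f₋` vanishes at `0`, and `sol_flux` adds a nonnegative amount at each site, the
first being `Im z`. -/
theorem fMinus_flux_pos {z : ℂ} (hz : z ∈ upperHalf) (n : ℕ) :
    0 < c.a (n + 1) * (c.fMinus (n + 2) z * (starRingEnd ℂ) (c.fMinus (n + 1) z)).im := by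
  have hz' : 0 < z.im := hz
  induction n with
  | zero =>
    have h := c.sol_flux 0 1 z 0
    simp only [fMinus]
    rw [h]
    simpa [sol] using hz'
  | succ n ih =>
    have h := c.sol_flux 0 1 z (n + 1)
    simp only [fMinus] at ih ⊢
    rw [h]
    exact add_pos_of_pos_of_nonneg ih (mul_nonneg hz'.le (normSq_nonneg _))

theorem fMinus_ne_zero {z : ℂ} (hz : z ∈ upperHalf) (n : ℕ) : c.fMinus (n + 1) z ≠ 0 := by
  intro h
  have := c.fMinus_flux_pos hz n
  rw [h] at this
  simp at this

theorem fMinus_ratio_im_pos {z : ℂ} (hz : z ∈ upperHalf) (n : ℕ) :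
    0 < (c.fMinus (n + 2) z / c.fMinus (n + 1) z).im := by
  rw [div_im_eq]
  exact div_pos (pos_of_mul_pos_right (c.fMinus_flux_pos hz n) (c.a_pos _).le)
    (normSq_pos.2 (c.fMinus_ne_zero hz n))

theorem fPlus_flux_antitone {z : ℂ} (hz : z ∈ upperHalf) :
    Antitone fun n => -(c.a n * (c.fPlus (n + 1) z * (starRingEnd ℂ) (c.fPlus n z)).im) := by
  refine antitone_nat_of_succ_le fun n => ?_
  have h := c.sol_flux 1 (-c.mPlus z) z n
  have hz' : 0 < z.im := hz
  have := mul_nonneg hz'.le (normSq_nonneg (c.sol 1 (-c.mPlus z) z (n + 1)))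
  simp only [fPlus]
  linarith

/-- A single constant for all later estimates, which also covers `a 0 = 1`. -/
theorem exists_bound : ∃ K : ℝ, 1 ≤ K ∧ (∀ n, K⁻¹ ≤ c.a n) ∧ (∀ n, c.a n ≤ K) ∧
    ∀ n, |c.b (n + 1)| ≤ K := by
  obtain ⟨C, hC, h⟩ := c.bounded
  refine ⟨C + 1, by linarith, fun n => ?_, fun n => ?_, fun n => ?_⟩
  · rcases Nat.eq_zero_or_pos n with rfl | hn
    · rw [c.a_zero]; exact inv_le_one_of_one_le₀ (by linarith)
    · exact (h n hn).1
  · rcases Nat.eq_zero_or_pos n with rfl | hn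
    · rw [c.a_zero]; linarith
    · exact (h n hn).2.1
  · exact (h (n + 1) (by omega)).2.2.trans (by linarith)

/-- A decreasing sequence lies above its limit, and the limit is `0` because `f₊` decays and `a` is
bounded. -/
theorem fPlus_flux_nonneg {z : ℂ} (hz : z ∈ upperHalf) (n : ℕ) :
    0 ≤ -(c.a n * (c.fPlus (n + 1) z * (starRingEnd ℂ) (c.fPlus n z)).im) := by
  obtain ⟨K, hK, -, ha, -⟩ := c.exists_bound
  refine (c.fPlus_flux_antitone hz).le_of_tendsto ?_ n
  have h0 := c.tendsto_fPlus hz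
  have h1 := (tendsto_add_atTop_iff_nat (f := fun n => c.fPlus n z) 1).2 h0
  have h2 : Tendsto (fun n => K * (‖c.fPlus (n + 1) z‖ * ‖c.fPlus n z‖)) atTop (𝓝 0) := by
    simpa using ((h1.norm).mul h0.norm).const_mul K
  refine squeeze_zero_norm (fun n => ?_) h2
  rw [norm_neg, norm_mul, Real.norm_of_nonneg (c.a_pos n).le]
  refine mul_le_mul (ha n) ?_ (norm_nonneg _) (by linarith)
  refine (Complex.abs_im_le_norm _).trans ?_
  rw [norm_mul, RCLike.norm_conj]

theorem fPlus_eq_zero_back {z : ℂ} {n : ℕ} (h1 : c.fPlus (n + 1) z = 0) :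
    c.fPlus n z = 0 → False := by
  induction n with
  | zero => intro h; simp [fPlus, sol] at h
  | succ n ih =>
    intro h
    refine ih h ?_
    have hr := c.sol_recurrence 1 (-c.mPlus z) z n
    simp only [fPlus] at h1 h ⊢
    rw [h1, h] at hr
    simpa [c.a_ne_zero] using hr

/-- If the flux vanished at `n`, nonnegativity two sites later would force `f₊` to vanish at `n + 1`
and `n + 2`. Two consecutive zeros propagate back to `f₊(0) = 1`. -/
theorem fPlus_flux_pos {z : ℂ} (hz : z ∈ upperHalf) (n : ℕ) :
    0 < -(c.a n * (c.fPlus (n + 1) z * (starRingEnd ℂ) (c.fPlus n z)).im) := by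
  have hz' : 0 < z.im := hz
  have h1 := c.sol_flux 1 (-c.mPlus z) z n
  have h2 := c.sol_flux 1 (-c.mPlus z) z (n + 1)
  have h3 := c.fPlus_flux_nonneg hz (n + 2)
  have e1 := mul_nonneg hz'.le (normSq_nonneg (c.fPlus (n + 1) z))
  have e2 := mul_nonneg hz'.le (normSq_nonneg (c.fPlus (n + 2) z))
  refine lt_of_le_of_ne (c.fPlus_flux_nonneg hz n) fun h0 => ?_
  simp only [fPlus] at h0 h3 e1 e2
  have z1 : z.im * normSq (c.sol 1 (-c.mPlus z) z (n + 1)) = 0 := by linarith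
  have z2 : z.im * normSq (c.sol 1 (-c.mPlus z) z (n + 2)) = 0 := by linarith
  have w1 := normSq_eq_zero.1 ((mul_eq_zero.1 z1).resolve_left hz'.ne')
  have w2 := normSq_eq_zero.1 ((mul_eq_zero.1 z2).resolve_left hz'.ne')
  exact c.fPlus_eq_zero_back (n := n + 1) w2 w1

theorem fPlus_ne_zero {z : ℂ} (hz : z ∈ upperHalf) (n : ℕ) : c.fPlus n z ≠ 0 := by
  intro h
  have := c.fPlus_flux_pos hz n
  rw [h] at this
  simp at this

theorem fPlus_ratio_im_pos {z : ℂ} (hz : z ∈ upperHalf) (n : ℕ) :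
    0 < (-(c.fPlus (n + 1) z / c.fPlus n z)).im := by
  rw [neg_im, div_im_eq, ← neg_div]
  refine div_pos ?_ (normSq_pos.2 (c.fPlus_ne_zero hz n))
  have := c.fPlus_flux_pos hz n
  rw [← mul_neg] at this
  exact pos_of_mul_pos_right this (c.a_pos _).le

theorem a_mul_mMinusAt (n : ℕ) (z : ℂ) :
    c.a n * c.mMinusAt n z = c.fMinus (n + 1) z / c.fMinus n z := by
  rw [mMinusAt, ← mul_div_assoc, mul_div_mul_left _ _ (c.a_ne_zero n)]

theorem a_mul_mPlusAt (n : ℕ) (z : ℂ) :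
    c.a n * c.mPlusAt n z = -(c.fPlus (n + 1) z / c.fPlus n z) := by
  rw [mPlusAt, mul_neg, ← mul_div_assoc, mul_div_mul_left _ _ (c.a_ne_zero n)]

end JacobiCoeff

/-! ### Spectral measures and the Stieltjes transform of the limit of `ν_N` -/

/-- The diagonal matrix element `⟨ψ, f(T) ψ⟩` of the real functional calculus. -/
def spectralForm {H : Type*} [NormedAddCommGroup H] [InnerProductSpace ℂ H] [CompleteSpace H]
    (T : H →L[ℂ] H) (ψ : H) (f : ℝ → ℝ) : ℝ := (inner ℂ ψ (cfc f T ψ)).re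

theorem integral_spectralMeasure {H : Type*} [NormedAddCommGroup H] [InnerProductSpace ℂ H]
    [CompleteSpace H] (T : H →L[ℂ] H) (ψ : H) {f : ℝ → ℝ} (hf : Continuous f)
    (hs : HasCompactSupport f) :
    ∫ t, f t ∂(spectralMeasure T ψ) = spectralForm T ψ f :=
  RealRMK.integral_rieszMeasure (spectralFunctional T ψ)
    (⟨⟨f, hf⟩, hs⟩ : CompactlySupportedContinuousMap ℝ ℝ)

instance {H : Type*} [NormedAddCommGroup H] [InnerProductSpace ℂ H] [CompleteSpace H]
    (T : H →L[ℂ] H) (ψ : H) : IsFiniteMeasureOnCompacts (spectralMeasure T ψ) := by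
  unfold spectralMeasure
  infer_instance

/-- The spectrum lies in `[-‖T‖, ‖T‖]`, and the functional calculus only sees values there. -/
theorem spectralForm_congr {H : Type*} [NormedAddCommGroup H] [InnerProductSpace ℂ H]
    [CompleteSpace H] [Nontrivial H] (T : H →L[ℂ] H) (ψ : H) {f g : ℝ → ℝ}
    (h : ∀ t, |t| ≤ ‖T‖ → f t = g t) : spectralForm T ψ f = spectralForm T ψ g := by
  have : cfc f T = cfc g T := cfc_congr fun t ht => h t (spectrum.norm_le_norm_of_mem ht)
  rw [spectralForm, this, spectralForm]

theorem spectralForm_zero {H : Type*} [NormedAddCommGroup H] [InnerProductSpace ℂ H]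
    [CompleteSpace H] (T : H →L[ℂ] H) (ψ : H) : spectralForm T ψ (fun _ => 0) = 0 := by
  have : cfc (fun _ : ℝ => (0 : ℝ)) T = 0 := cfc_const_zero ℝ T
  rw [spectralForm, this]
  simp

instance : Nontrivial HalfLine := ⟨⟨delta 0, 0, fun h => by
  have := congrArg (fun u : HalfLine => u 0) h
  simp [JacobiCoeff.delta_apply] at this⟩⟩

/-- The resolvent in terms of the real functional calculus. -/
theorem inverse_eq_cfc {H : Type*} [NormedAddCommGroup H] [InnerProductSpace ℂ H]
    [CompleteSpace H] {T : H →L[ℂ] H} (hT : IsSelfAdjoint T) {z : ℂ} (hz : z ∈ upperHalf)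
    (hu : IsUnit (T - z • (1 : H →L[ℂ] H))) :
    Ring.inverse (T - z • (1 : H →L[ℂ] H)) =
      cfc (fun t : ℝ => (1 / ((t : ℂ) - z)).re) T
        + I • cfc (fun t : ℝ => (1 / ((t : ℂ) - z)).im) T := by
  set φ : ℝ → ℝ := fun t => (1 / ((t : ℂ) - z)).re with hφ
  set χ : ℝ → ℝ := fun t => (1 / ((t : ℂ) - z)).im with hχ
  have cφ : Continuous φ := continuous_re.comp (continuous_inv_sub hz)
  have cχ : Continuous χ := continuous_im.comp (continuous_inv_sub hz)
  have key : ∀ t : ℝ, ((t : ℂ) - z) * (φ t + I * χ t) = 1 := by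
    intro t
    have : (φ t + I * χ t : ℂ) = 1 / ((t : ℂ) - z) := by
      rw [mul_comm I]; exact re_add_im _
    rw [this, mul_one_div_cancel (ofReal_sub_ne_zero hz t)]
  -- The calculus is over `ℝ`, so the identity `(t - z)(φ + iχ) = 1` is split into its real and
  -- imaginary parts, solved for `t φ` and `t χ`.
  have hr : ∀ t, t * φ t = 1 + (z.re * φ t + (-z.im) * χ t) := fun t => by
    have := congrArg re (key t)
    simp at this
    linarith
  have hi : ∀ t, t * χ t = z.re * χ t + z.im * φ t := fun t => by
    have := congrArg im (key t)
    simp at this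
    linarith
  have h1 : T * cfc φ T = 1 + (z.re • cfc φ T + (-z.im) • cfc χ T) := by
    rw [← cfc_smul _ _ _ cφ.continuousOn, ← cfc_smul _ _ _ cχ.continuousOn,
      ← cfc_add _ _ _ (by fun_prop) (by fun_prop), ← cfc_one ℝ T,
      ← cfc_add _ _ _ (by fun_prop) (by fun_prop)]
    nth_rw 1 [← cfc_id ℝ T]
    rw [← cfc_mul _ _ _ (by fun_prop) (by fun_prop)]
    exact cfc_congr fun t _ => hr t
  have h2 : T * cfc χ T = z.re • cfc χ T + z.im • cfc φ T := by
    rw [← cfc_smul _ _ _ cφ.continuousOn, ← cfc_smul _ _ _ cχ.continuousOn,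
      ← cfc_add _ _ _ (by fun_prop) (by fun_prop)]
    nth_rw 1 [← cfc_id ℝ T]
    rw [← cfc_mul _ _ _ (by fun_prop) (by fun_prop)]
    exact cfc_congr fun t _ => hi t
  have h3 : (T - z • (1 : H →L[ℂ] H)) * (cfc φ T + I • cfc χ T) = 1 := by
    rw [sub_mul, mul_add, mul_smul_comm, h1, h2, smul_mul_assoc, one_mul]
    have hzz : z = z.re + z.im * I := (re_add_im z).symm
    set x := z.re
    set y := z.im
    rw [hzz]
    have e : ∀ (r : ℝ) (S : H →L[ℂ] H), r • S = (r : ℂ) • S := fun r S => rfl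
    simp only [e]
    push_cast
    match_scalars
    all_goals first | ring1 | linear_combination (-(y : ℂ)) * I_sq
  calc Ring.inverse (T - z • (1 : H →L[ℂ] H))
      = Ring.inverse (T - z • (1 : H →L[ℂ] H)) *
        ((T - z • (1 : H →L[ℂ] H)) * (cfc φ T + I • cfc χ T)) := by rw [h3, mul_one]
    _ = _ := by rw [← mul_assoc, Ring.inverse_mul_cancel _ hu, one_mul]

theorem inner_cfc_im {H : Type*} [NormedAddCommGroup H] [InnerProductSpace ℂ H]
    [CompleteSpace H] (T : H →L[ℂ] H) (φ : ℝ → ℝ) (ψ : H) :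
    (inner ℂ ψ (cfc φ T ψ)).im = 0 := by
  have h : IsSelfAdjoint (cfc φ T) := cfc_predicate φ T
  have h2 : inner ℂ (cfc φ T ψ) ψ = inner ℂ ψ (cfc φ T ψ) := by
    conv_rhs => rw [← ContinuousLinearMap.isSelfAdjoint_iff'.1 h]
    rw [ContinuousLinearMap.adjoint_inner_right]
  have h3 := inner_conj_symm (𝕜 := ℂ) ψ (cfc φ T ψ)
  rw [h2] at h3
  exact conj_eq_iff_im.1 h3

theorem inner_inverse_eq {H : Type*} [NormedAddCommGroup H] [InnerProductSpace ℂ H]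
    [CompleteSpace H] {T : H →L[ℂ] H} (hT : IsSelfAdjoint T) {z : ℂ} (hz : z ∈ upperHalf)
    (hu : IsUnit (T - z • (1 : H →L[ℂ] H))) (ψ : H) :
    (inner ℂ ψ (Ring.inverse (T - z • (1 : H →L[ℂ] H)) ψ)).re
        = spectralForm T ψ (fun t : ℝ => (1 / ((t : ℂ) - z)).re) ∧
      (inner ℂ ψ (Ring.inverse (T - z • (1 : H →L[ℂ] H)) ψ)).im
        = spectralForm T ψ (fun t : ℝ => (1 / ((t : ℂ) - z)).im) := by
  have h1 := inner_cfc_im T (fun t : ℝ => (1 / ((t : ℂ) - z)).re) ψ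
  have h2 := inner_cfc_im T (fun t : ℝ => (1 / ((t : ℂ) - z)).im) ψ
  rw [inverse_eq_cfc hT hz hu]
  simp only [_root_.add_apply, _root_.smul_apply, inner_add_right, inner_smul_right]
  constructor
  · rw [add_re, I_mul_re, h2, neg_zero, add_zero, spectralForm]
  · rw [add_im, I_mul_im, h1, zero_add, spectralForm]

namespace JacobiCoeff

variable (c : JacobiCoeff)

theorem integral_nuN (N : ℕ) {f : ℝ → ℝ} (hf : Continuous f) (hs : HasCompactSupport f) :
    ∫ t, f t ∂(c.nuN N) = (1 / N : ℝ) *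
      ∑ i ∈ Finset.range N, spectralForm c.op (delta i) f := by
  rw [nuN, integral_smul_measure, integral_finsetSum_measure]
  · simp only [integral_spectralMeasure _ _ hf hs]
    simp
  · intro i _
    exact hf.integrable_of_hasCompactSupport hs

theorem integral_nuN_eq_zero (N : ℕ) {f : ℝ → ℝ} (hf : Continuous f) (hs : HasCompactSupport f)
    (h : ∀ t, |t| ≤ ‖c.op‖ → f t = 0) : ∫ t, f t ∂(c.nuN N) = 0 := by
  rw [c.integral_nuN N hf hs]
  simp only [spectralForm_congr c.op _ h, spectralForm_zero]
  simp

/-- The resolvent kernel has no compact support. The cutoff makes it an admissible test function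
and, being `1` on the spectrum, costs nothing. -/
theorem integral_nuN_cutoff (N : ℕ) {M : ℝ} (hM : ‖c.op‖ ≤ M) {z : ℂ} (hz : z ∈ upperHalf) :
    ∫ t, cutoff M t * (1 / ((t : ℂ) - z)).re ∂(c.nuN N) = (c.gN N z).re ∧
    ∫ t, cutoff M t * (1 / ((t : ℂ) - z)).im ∂(c.nuN N) = (c.gN N z).im := by
  have e : (1 / N : ℂ) = ((1 / N : ℝ) : ℂ) := by push_cast; rfl
  have h1 : ∀ (φ : ℝ → ℝ) (i : ℕ), spectralForm c.op (delta i) (fun t => cutoff M t * φ t)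
      = spectralForm c.op (delta i) φ := fun φ i =>
    spectralForm_congr _ _ fun t ht => by rw [cutoff_eq_one (ht.trans hM), one_mul]
  have h2 := fun i => inner_inverse_eq c.op_isSelfAdjoint hz (c.isUnit_op_sub hz) (delta i)
  constructor
  · rw [c.integral_nuN N (f := fun t => cutoff M t * (1 / ((t : ℂ) - z)).re)
      ((continuous_cutoff M).mul (continuous_re.comp (continuous_inv_sub hz)))
      (hasCompactSupport_cutoff M).mul_right, gN, e, re_ofReal_mul, re_sum]
    simp only [h1, green, (h2 _).1]
  · rw [c.integral_nuN N (f := fun t => cutoff M t * (1 / ((t : ℂ) - z)).im)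
      ((continuous_cutoff M).mul (continuous_im.comp (continuous_inv_sub hz)))
      (hasCompactSupport_cutoff M).mul_right, gN, e, im_ofReal_mul, im_sum]
    simp only [h1, green, (h2 _).2]

/-- Limits of `g_N` are Stieltjes transforms of limits of `ν_N`. -/
theorem stieltjes_of_tendsto {N : ℕ → ℕ} {ν : Measure ℝ} [IsFiniteMeasure ν]
    (hNu : TendstoWeakStar (fun j => c.nuN (N j)) ν) :
    (∀ᵐ t ∂ν, |t| ≤ ‖c.op‖) ∧ ∀ z ∈ upperHalf,
      Tendsto (fun j => c.gN (N j) z) atTop (𝓝 (∫ t : ℝ, 1 / ((t : ℂ) - z) ∂ν)) := by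
  have hM : ∀ᵐ t ∂ν, |t| ≤ ‖c.op‖ :=
    hNu.ae_abs_le fun f hf hs h j => c.integral_nuN_eq_zero (N j) hf hs h
  refine ⟨hM, fun z hz => ?_⟩
  have hint := integrable_of_ae_abs_le hM (continuous_inv_sub hz)
  have h1 := hNu.tendsto_cutoff hM (continuous_re.comp (continuous_inv_sub hz))
  have h2 := hNu.tendsto_cutoff hM (continuous_im.comp (continuous_inv_sub hz))
  simp only [Function.comp_def] at h1 h2
  simp only [(c.integral_nuN_cutoff _ le_rfl hz).1] at h1
  simp only [(c.integral_nuN_cutoff _ le_rfl hz).2] at h2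
  have h3 := ((continuous_ofReal.tendsto _).comp h1).add
    (((continuous_ofReal.tendsto _).comp h2).mul_const I)
  simp only [Function.comp_def, re_add_im] at h3
  convert h3 using 2
  have e1 : ∫ t : ℝ, (1 / ((t : ℂ) - z)).re ∂ν = (∫ t : ℝ, 1 / ((t : ℂ) - z) ∂ν).re :=
    integral_re hint
  have e2 : ∫ t : ℝ, (1 / ((t : ℂ) - z)).im ∂ν = (∫ t : ℝ, 1 / ((t : ℂ) - z) ∂ν).im :=
    integral_im hint
  rw [e1, e2, re_add_im]

/-! ### Truncated matrices, their eigenvalues and `Re w₋` -/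

open Polynomial in
/-- The charpoly recursion of the truncated matrices. -/
theorem charpoly_truncation_succ (N : ℕ) :
    (c.truncation (N + 2)).charpoly = (X - C (c.b (N + 2))) * (c.truncation (N + 1)).charpoly
      - C (c.a (N + 1) ^ 2) * (c.truncation N).charpoly := by
  have hsub : ∀ n, (c.truncation (n + 1)).charmatrix.submatrix Fin.castSucc Fin.castSucc
      = (c.truncation n).charmatrix := by
    intro n
    ext1 i j
    simp [Matrix.charmatrix_apply, Matrix.diagonal_apply, truncation]
  set B := (c.truncation (N + 2)).charmatrix with hB
  have hentry : ∀ i j, B i j = (if i = j then X else 0) - C (c.truncation (N + 2) i j) := by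
    intro i j
    rw [hB, Matrix.charmatrix_apply, Matrix.diagonal_apply]
  have hlast : B (Fin.last _) (Fin.last _) = X - C (c.b (N + 2)) := by
    rw [hentry]; simp [truncation]
  have hoff : B (Fin.last _) (Fin.castSucc (Fin.last _)) = -C (c.a (N + 1)) := by
    rw [hentry]; simp [truncation, Fin.ext_iff]
    intro h
    omega
  have hoff' : B (Fin.castSucc (Fin.last _)) (Fin.last _) = -C (c.a (N + 1)) := by
    rw [hentry]; simp [truncation, Fin.ext_iff]
  have hzero : ∀ j : Fin N, B (Fin.last _) (Fin.castSucc (Fin.castSucc j)) = 0 := by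
    intro j
    rw [hentry]
    have := j.2
    simp [truncation, Fin.ext_iff]
    split_ifs <;> first | omega | simp
  have hzero' : ∀ j : Fin N, B (Fin.castSucc (Fin.castSucc j)) (Fin.last _) = 0 := by
    intro j
    rw [hentry]
    have := j.2
    simp [truncation, Fin.ext_iff]
    split_ifs <;> first | omega | simp
  -- In this minor the last column has only its corner entry, so one more expansion leaves the
  -- matrix two sizes smaller.
  have hminor : (B.submatrix Fin.castSucc (Fin.castSucc (Fin.last N)).succAbove).det
      = -C (c.a (N + 1)) * (c.truncation N).charpoly := by
    rw [Matrix.det_succ_column _ (Fin.last N), Fin.sum_univ_castSucc]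
    rw [Finset.sum_eq_zero, zero_add]
    · have e : (Fin.castSucc (Fin.last N)).succAbove (Fin.last N) = Fin.last (N + 1) := by
        simp
      have e2 : (B.submatrix Fin.castSucc (Fin.castSucc (Fin.last N)).succAbove).submatrix
          (Fin.last N).succAbove (Fin.last N).succAbove = (c.truncation N).charmatrix := by
        rw [← hsub N, ← hsub (N + 1), Matrix.submatrix_submatrix, Matrix.submatrix_submatrix]
        congr 1
        · ext i; simp
        · ext i
          simp [Fin.succAbove]
      rw [e2, Matrix.submatrix_apply, e, hoff', Matrix.charpoly]
      simp
    · intro j _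
      have e : (Fin.castSucc (Fin.last N)).succAbove (Fin.last N) = Fin.last (N + 1) := by
        simp
      rw [Matrix.submatrix_apply, e, hzero']
      simp
  rw [Matrix.charpoly, ← hB, Matrix.det_succ_row B (Fin.last (N + 1)), Fin.sum_univ_castSucc,
    Fin.sum_univ_castSucc, Finset.sum_eq_zero, zero_add, hlast, hoff, Fin.succAbove_last]
  · rw [hminor, hB, hsub (N + 1), ← Matrix.charpoly]
    have e1 : (-1 : ℝ[X]) ^ (((Fin.last (N + 1) : Fin (N + 2)) : ℕ)
        + ((Fin.castSucc (Fin.last N) : Fin (N + 2)) : ℕ)) = -1 := by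
      simp only [Fin.val_last, Fin.val_castSucc]
      exact Odd.neg_one_pow ⟨N, by ring⟩
    have e2 : (-1 : ℝ[X]) ^ (((Fin.last (N + 1) : Fin (N + 2)) : ℕ)
        + ((Fin.last (N + 1) : Fin (N + 2)) : ℕ)) = 1 := Even.neg_one_pow ⟨_, rfl⟩
    rw [e1, e2, C_pow]
    ring
  · intro j _
    rw [hzero]
    simp

open Polynomial in
theorem charpoly_truncation_eval (N : ℕ) (z : ℂ) :
    aeval z (c.truncation N).charpoly
      = (∏ n ∈ Finset.Icc 1 N, (c.a n : ℂ)) * c.fMinus (N + 1) z := by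
  induction N using Nat.twoStepInduction with
  | zero => simp [fMinus, sol, Matrix.charpoly]
  | one =>
    have h : (c.truncation 1).charpoly = X - C (c.b 1) := by
      rw [Matrix.charpoly, Matrix.det_fin_one, Matrix.charmatrix_apply]
      simp [truncation]
    have h2 := c.sol_recurrence 0 1 z 0
    rw [h]
    simp only [fMinus]
    simp only [sol] at h2 ⊢
    simp at h2 ⊢
    rw [h2]
  | more N ih1 ih2 =>
    rw [charpoly_truncation_succ, map_sub, map_mul, map_mul, ih1, ih2]
    have h2 := c.sol_recurrence 0 1 z (N + 1)
    simp only [fMinus]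
    rw [Finset.prod_Icc_succ_top (by omega : 1 ≤ N + 1 + 1),
      Finset.prod_Icc_succ_top (by omega : 1 ≤ N + 1)]
    simp only [map_sub, aeval_X, aeval_C, coe_algebraMap]
    push_cast
    linear_combination -(∏ n ∈ Finset.Icc 1 N, (c.a n : ℂ)) * c.a (N + 1) * h2

open Polynomial in
theorem prod_sub_eigenvalues (N : ℕ) (z : ℂ) :
    ∏ i, (z - ((c.truncation_isHermitian N).eigenvalues i : ℝ))
      = (∏ n ∈ Finset.Icc 1 N, (c.a n : ℂ)) * c.fMinus (N + 1) z := by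
  rw [← charpoly_truncation_eval, (c.truncation_isHermitian N).charpoly_eq, map_prod]
  simp

/-- Gershgorin: the diagonal entry is at most `K` in modulus, and a row has at most two off-diagonal
entries, each at most `K`. -/
theorem exists_abs_eigenvalue_le : ∃ M : ℝ, ∀ N i,
    |(c.truncation_isHermitian N).eigenvalues i| ≤ M := by
  obtain ⟨K, hK, -, ha, hb⟩ := c.exists_bound
  refine ⟨K + (K + K), fun N i => ?_⟩
  set hA := c.truncation_isHermitian N
  have hev : Module.End.HasEigenvalue (Matrix.toLin' (c.truncation N)) (hA.eigenvalues i) := by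
    rw [Module.End.hasEigenvalue_iff_mem_spectrum, Matrix.spectrum_toLin']
    exact hA.eigenvalues_mem_spectrum_real i
  obtain ⟨k, hk⟩ := eigenvalue_mem_ball hev
  rw [Metric.mem_closedBall, Real.dist_eq] at hk
  have hd : |c.truncation N k k| ≤ K := by simpa [truncation] using hb k
  have hs : ∑ j ∈ Finset.univ.erase k, ‖c.truncation N k j‖ ≤ K + K := by
    have h1 : ∀ j ∈ Finset.univ.erase k, ‖c.truncation N k j‖ ≤
        (if (j : ℕ) = k + 1 then K else 0) + (if (k : ℕ) = j + 1 then K else 0) := by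
      intro j hj
      have hne : (k : ℕ) ≠ j := fun h => (Finset.ne_of_mem_erase hj) (Fin.ext h.symm)
      simp only [truncation, if_neg hne]
      split_ifs
      · omega
      · rw [Real.norm_of_nonneg (c.a_pos _).le, add_zero]; exact ha _
      · rw [Real.norm_of_nonneg (c.a_pos _).le, zero_add]; exact ha _
      · simp
    refine (Finset.sum_le_sum h1).trans ?_
    rw [Finset.sum_add_distrib]
    refine add_le_add ?_ ?_
    · rw [Finset.sum_ite, Finset.sum_const_zero, add_zero, Finset.sum_const, nsmul_eq_mul]
      have : (Finset.filter (fun j : Fin N => (j : ℕ) = k + 1) (Finset.univ.erase k)).card ≤ 1 :=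
        Finset.card_le_one.2 fun x hx y hy => Fin.ext
          ((Finset.mem_filter.1 hx).2.trans (Finset.mem_filter.1 hy).2.symm)
      have : ((Finset.filter (fun j : Fin N => (j : ℕ) = k + 1)
        (Finset.univ.erase k)).card : ℝ) ≤ 1 := by exact_mod_cast this
      nlinarith
    · rw [Finset.sum_ite, Finset.sum_const_zero, add_zero, Finset.sum_const, nsmul_eq_mul]
      have : (Finset.filter (fun j : Fin N => (k : ℕ) = j + 1) (Finset.univ.erase k)).card ≤ 1 :=
        Finset.card_le_one.2 fun x hx y hy => Fin.ext (by
          have h1 := (Finset.mem_filter.1 hx).2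
          have h2 := (Finset.mem_filter.1 hy).2
          omega)
      have : ((Finset.filter (fun j : Fin N => (k : ℕ) = j + 1)
        (Finset.univ.erase k)).card : ℝ) ≤ 1 := by exact_mod_cast this
      nlinarith
  have h3 := abs_sub_abs_le_abs_sub (hA.eigenvalues i) (c.truncation N k k)
  linarith

theorem integral_kN (N : ℕ) (f : ℝ → ℝ) :
    ∫ t, f t ∂(c.kN N)
      = (1 / N : ℝ) * ∑ i, f ((c.truncation_isHermitian N).eigenvalues i) := by
  rw [kN, integral_smul_measure, integral_finsetSum_measure]
  · simp
  · intro i _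
    exact integrable_dirac (by simp)

/-- The logarithms of the moduli telescope from `f₋(1) = 1` to `f₋(N+1)`, which factors over the
eigenvalues. -/
theorem wMinusN_re (N : ℕ) {z : ℂ} (hz : z ∈ upperHalf) :
    (c.wMinusN N z).re = (1 / N : ℝ) *
        ∑ i, Real.log ‖((c.truncation_isHermitian N).eigenvalues i : ℂ) - z‖
      - (1 / N : ℝ) * Real.log (∏ n ∈ Finset.Icc 1 N, c.a n) := by
  have h1 : (∑ n ∈ Finset.Icc 1 N, Complex.log (c.a n * c.mMinusAt n z)).re
      = Real.log ‖c.fMinus (N + 1) z‖ := by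
    induction N with
    | zero => simp [fMinus, sol]
    | succ N ih =>
      rw [Finset.sum_Icc_succ_top (by omega), add_re, ih, a_mul_mMinusAt, log_re, norm_div,
        Real.log_div (norm_ne_zero_iff.2 (c.fMinus_ne_zero hz _))
          (norm_ne_zero_iff.2 (c.fMinus_ne_zero hz _))]
      ring
  have e : (1 / N : ℂ) = ((1 / N : ℝ) : ℂ) := by push_cast; rfl
  have hpos : 0 < ∏ n ∈ Finset.Icc 1 N, c.a n := Finset.prod_pos fun n _ => c.a_pos n
  have h2 : ∑ i, Real.log ‖((c.truncation_isHermitian N).eigenvalues i : ℂ) - z‖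
      = Real.log (∏ n ∈ Finset.Icc 1 N, c.a n) + Real.log ‖c.fMinus (N + 1) z‖ := by
    rw [← Real.log_prod fun i _ => norm_ne_zero_iff.2 (ofReal_sub_ne_zero hz _)]
    simp only [norm_sub_rev _ z]
    rw [← norm_prod, c.prod_sub_eigenvalues, norm_mul,
      Real.log_mul _ (norm_ne_zero_iff.2 (c.fMinus_ne_zero hz _)), ← ofReal_prod,
      norm_real, Real.norm_of_nonneg hpos.le]
    rw [← ofReal_prod, norm_real]
    exact norm_ne_zero_iff.2 hpos.ne'
  rw [wMinusN, e, re_ofReal_mul, h1, h2]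
  ring

/-- The real part of a limit of `w₋^{(N)}` in terms of the limit of `k_N`. -/
theorem tendsto_wMinusN_re {N : ℕ → ℕ} {κ : Measure ℝ} [IsFiniteMeasure κ] {A : ℝ} (hA : 0 < A)
    (hK : TendstoWeakStar (fun j => c.kN (N j)) κ)
    (hAlim : Tendsto (fun j => (∏ n ∈ Finset.Icc 1 (N j), c.a n) ^ (1 / (N j : ℝ)))
      atTop (𝓝 A)) :
    ∃ M : ℝ, (∀ᵐ t ∂κ, |t| ≤ M) ∧ ∀ z ∈ upperHalf,
      Tendsto (fun j => (c.wMinusN (N j) z).re) atTop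
        (𝓝 ((logPotential κ z).re - Real.log A)) := by
  obtain ⟨M, hM⟩ := c.exists_abs_eigenvalue_le
  have hae : ∀ᵐ t ∂κ, |t| ≤ M := hK.ae_abs_le fun f _ _ h j => by
    rw [integral_kN, Finset.sum_eq_zero fun i _ => h _ (hM _ _), mul_zero]
  refine ⟨M, hae, fun z hz => ?_⟩
  have h1 := hK.tendsto_cutoff hae (continuous_re.comp (continuous_log_sub hz))
  have e : ∫ t : ℝ, (Complex.log ((t : ℂ) - z)).re ∂κ = (logPotential κ z).re :=
    integral_re (integrable_of_ae_abs_le hae (continuous_log_sub hz))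
  simp only [Function.comp_def, e] at h1
  have h2 := (Real.continuousAt_log hA.ne').tendsto.comp hAlim
  refine (h1.sub h2).congr fun j => ?_
  rw [c.wMinusN_re _ hz, integral_kN, Function.comp_apply,
    Real.log_rpow (Finset.prod_pos fun n _ => c.a_pos n)]
  simp only [cutoff_eq_one (hM _ _), one_mul, log_re]

/-! ### Riccati equations and bounds uniform in the site -/

theorem fMinus_ratio_eq {z : ℂ} (hz : z ∈ upperHalf) (n : ℕ) :
    c.a (n + 1) * (c.fMinus (n + 2) z / c.fMinus (n + 1) z)
      = z - c.b (n + 1) - c.a n * (c.fMinus n z / c.fMinus (n + 1) z) := by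
  have h := c.sol_recurrence 0 1 z n
  have h0 := c.fMinus_ne_zero hz n
  simp only [fMinus] at h0 ⊢
  field_simp
  linear_combination h

theorem fPlus_ratio_eq {z : ℂ} (hz : z ∈ upperHalf) (n : ℕ) :
    c.a n * (c.fPlus n z / c.fPlus (n + 1) z)
      = z - c.b (n + 1) + c.a (n + 1) * -(c.fPlus (n + 2) z / c.fPlus (n + 1) z) := by
  have h := c.sol_recurrence 1 (-c.mPlus z) z n
  have h0 := c.fPlus_ne_zero hz (n + 1)
  simp only [fPlus] at h0 ⊢
  field_simp
  linear_combination h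

theorem fMinus_inv_ratio_im_nonpos {z : ℂ} (hz : z ∈ upperHalf) (n : ℕ) :
    (c.fMinus n z / c.fMinus (n + 1) z).im ≤ 0 := by
  rcases n with _ | n
  · simp [fMinus, sol]
  · rw [← inv_div, inv_im, neg_div]
    exact neg_nonpos.2 (div_nonneg (c.fMinus_ratio_im_pos hz n).le (normSq_nonneg _))

/-- In the Riccati equation the term with the inverse ratio only adds to the imaginary part, so at
least `Im z` remains. This lower bound also controls the inverse ratio in `norm_fMinus_ratio_le`. -/
theorem le_fMinus_ratio_im {K : ℝ} (hK : ∀ n, c.a n ≤ K) {z : ℂ} (hz : z ∈ upperHalf) (n : ℕ) :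
    z.im / K ≤ (c.fMinus (n + 2) z / c.fMinus (n + 1) z).im := by
  have hz' : 0 < z.im := hz
  have h := congrArg im (c.fMinus_ratio_eq hz n)
  rw [im_ofReal_mul, sub_im, sub_im, ofReal_im, im_ofReal_mul] at h
  have h1 := mul_nonpos_of_nonneg_of_nonpos (c.a_pos n).le (c.fMinus_inv_ratio_im_nonpos hz n)
  have hK0 : 0 < K := (c.a_pos 0).trans_le (hK 0)
  rw [div_le_iff₀ hK0]
  nlinarith [mul_le_mul_of_nonneg_right (hK (n + 1)) (c.fMinus_ratio_im_pos hz n).le]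

theorem norm_fMinus_ratio_le {K : ℝ} (hK : ∀ n, c.a n ≤ K) (hK' : ∀ n, K⁻¹ ≤ c.a n)
    (hb : ∀ n, |c.b (n + 1)| ≤ K) {z : ℂ} (hz : z ∈ upperHalf) (n : ℕ) :
    ‖c.fMinus (n + 2) z / c.fMinus (n + 1) z‖ ≤ K * (‖z‖ + K + K * (K / z.im)) := by
  have hz' : 0 < z.im := hz
  have hK0 : 0 < K := (c.a_pos 0).trans_le (hK 0)
  have h1 : ‖c.fMinus n z / c.fMinus (n + 1) z‖ ≤ K / z.im := by
    rcases n with _ | n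
    · simp only [fMinus, sol, zero_div, norm_zero]; positivity
    · rw [← inv_div, norm_inv, inv_le_comm₀ (norm_pos_iff.2 fun h => by
        have := c.fMinus_ratio_im_pos hz n
        rw [h] at this
        simp at this) (by positivity), inv_div]
      exact (c.le_fMinus_ratio_im hK hz n).trans ((le_abs_self _).trans (abs_im_le_norm _))
  have h2 : c.a (n + 1) * ‖c.fMinus (n + 2) z / c.fMinus (n + 1) z‖
      ≤ ‖z‖ + K + K * (K / z.im) := by
    have h := congrArg norm (c.fMinus_ratio_eq hz n)
    rw [norm_mul, norm_real, Real.norm_of_nonneg (c.a_pos _).le] at h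
    rw [h]
    refine (norm_sub_le _ _).trans (add_le_add ((norm_sub_le _ _).trans
      (add_le_add le_rfl ?_)) ?_)
    · rw [norm_real]; exact hb n
    · rw [norm_mul, norm_real, Real.norm_of_nonneg (c.a_pos _).le]
      exact mul_le_mul (hK n) h1 (norm_nonneg _) hK0.le
  have h3 := mul_le_mul_of_nonneg_right (hK' (n + 1))
    (norm_nonneg (c.fMinus (n + 2) z / c.fMinus (n + 1) z))
  calc ‖c.fMinus (n + 2) z / c.fMinus (n + 1) z‖
      = K * (K⁻¹ * ‖c.fMinus (n + 2) z / c.fMinus (n + 1) z‖) := by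
        rw [← mul_assoc, mul_inv_cancel₀ hK0.ne', one_mul]
    _ ≤ _ := mul_le_mul_of_nonneg_left (h3.trans h2) hK0.le

/-- The same mechanism, applied to the Riccati equation for the inverse ratio, bounds that inverse
from below. -/
theorem norm_fPlus_ratio_le {K : ℝ} (hK : ∀ n, c.a n ≤ K) {z : ℂ} (hz : z ∈ upperHalf) (n : ℕ) :
    ‖c.fPlus (n + 1) z / c.fPlus n z‖ ≤ K / z.im := by
  have hz' : 0 < z.im := hz
  have hK0 : 0 < K := (c.a_pos 0).trans_le (hK 0)
  have h := congrArg im (c.fPlus_ratio_eq hz n)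
  rw [im_ofReal_mul, add_im, sub_im, ofReal_im, im_ofReal_mul] at h
  have h1 := mul_nonneg (c.a_pos (n + 1)).le (c.fPlus_ratio_im_pos hz (n + 1)).le
  have h2 := (le_abs_self _).trans (abs_im_le_norm (c.fPlus n z / c.fPlus (n + 1) z))
  have h3 := mul_le_mul_of_nonneg_left h2 (c.a_pos n).le
  have h4 := mul_le_mul_of_nonneg_right (hK n) (norm_nonneg (c.fPlus n z / c.fPlus (n + 1) z))
  have h5 : z.im / K ≤ ‖c.fPlus n z / c.fPlus (n + 1) z‖ := by
    rw [div_le_iff₀ hK0]; linarith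
  rw [← inv_div, norm_inv, inv_le_comm₀ (lt_of_lt_of_le (by positivity) h5) (by positivity),
    inv_div]
  exact h5

/-- The Wronskian identity divided by `f₊ f₋`. The bracket is a sum of two terms with positive
imaginary part, so bounds from both sides on the Green function follow from those on the ratios. -/
theorem green_inv {z : ℂ} (hz : z ∈ upperHalf) (i : ℕ) :
    (c.green i z)⁻¹ = -(c.a (i + 1) * (c.fMinus (i + 2) z / c.fMinus (i + 1) z
      + -(c.fPlus (i + 2) z / c.fPlus (i + 1) z))) := by
  have h := c.wronskian z (i + 1)
  have h1 := c.fMinus_ne_zero hz i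
  have h2 := c.fPlus_ne_zero hz (i + 1)
  rw [c.green_eq hz, inv_eq_iff_eq_inv, eq_comm, inv_eq_iff_eq_inv, eq_comm]
  field_simp
  linear_combination -h

theorem green_inv_im_neg {z : ℂ} (hz : z ∈ upperHalf) (i : ℕ) : ((c.green i z)⁻¹).im < 0 := by
  rw [c.green_inv hz, neg_im, im_ofReal_mul, add_im, neg_lt_zero]
  exact mul_pos (c.a_pos _) (add_pos (c.fMinus_ratio_im_pos hz i) (c.fPlus_ratio_im_pos hz _))

theorem green_im_pos {z : ℂ} (hz : z ∈ upperHalf) (i : ℕ) : 0 < (c.green i z).im := by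
  have h := c.green_inv_im_neg hz i
  rw [inv_im, neg_div, neg_lt_zero] at h
  by_contra! h2
  exact absurd h (not_lt.2 (div_nonpos_of_nonpos_of_nonneg h2 (normSq_nonneg _)))

theorem norm_green_inv_le {K : ℝ} (hK : ∀ n, c.a n ≤ K) (hK' : ∀ n, K⁻¹ ≤ c.a n)
    (hb : ∀ n, |c.b (n + 1)| ≤ K) {z : ℂ} (hz : z ∈ upperHalf) (i : ℕ) :
    ‖(c.green i z)⁻¹‖ ≤ K * (K * (‖z‖ + K + K * (K / z.im)) + K / z.im) := by
  have hK0 : 0 < K := (c.a_pos 0).trans_le (hK 0)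
  rw [c.green_inv hz, norm_neg, norm_mul, norm_real, Real.norm_of_nonneg (c.a_pos _).le]
  refine mul_le_mul (hK _) ((norm_add_le _ _).trans (add_le_add
    (c.norm_fMinus_ratio_le hK hK' hb hz i) ?_)) (norm_nonneg _) hK0.le
  rw [norm_neg]
  exact c.norm_fPlus_ratio_le hK hz _

theorem le_norm_green_inv {K : ℝ} (hK : ∀ n, c.a n ≤ K) (hK' : ∀ n, K⁻¹ ≤ c.a n)
    {z : ℂ} (hz : z ∈ upperHalf) (i : ℕ) :
    K⁻¹ * (z.im / K) ≤ ‖(c.green i z)⁻¹‖ := by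
  have hz' : 0 < z.im := hz
  have hK0 : 0 < K := (c.a_pos 0).trans_le (hK 0)
  rw [c.green_inv hz, norm_neg, norm_mul, norm_real, Real.norm_of_nonneg (c.a_pos _).le]
  refine mul_le_mul (hK' _) ?_ (by positivity) (c.a_pos _).le
  refine le_trans ?_ ((le_abs_self _).trans (abs_im_le_norm _))
  rw [add_im]
  linarith [c.le_fMinus_ratio_im hK hz i, c.fPlus_ratio_im_pos hz (i + 1)]

theorem exists_norm_log_green_le {z : ℂ} (hz : z ∈ upperHalf) :
    ∃ B : ℝ, ∀ i, ‖Complex.log (c.green i z)‖ ≤ B := by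
  have hz' : 0 < z.im := hz
  obtain ⟨K, hK1, hK', hK, hb⟩ := c.exists_bound
  set l := K⁻¹ * (z.im / K)
  have hl : 0 < l := by positivity
  set u := K * (K * (‖z‖ + K + K * (K / z.im)) + K / z.im)
  refine ⟨(|Real.log l| + |Real.log u|) + Real.pi, fun i => ?_⟩
  refine (norm_le_abs_re_add_abs_im _).trans (add_le_add ?_ ?_)
  · have h1 := c.le_norm_green_inv hK hK' hz i
    have h2 := c.norm_green_inv_le hK hK' hb hz i
    have h3 := Real.log_le_log hl h1
    have h4 := Real.log_le_log (hl.trans_le h1) h2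
    rw [log_re, ← neg_neg (Real.log _), abs_neg, ← Real.log_inv, ← norm_inv, abs_le]
    constructor <;> linarith [neg_abs_le (Real.log l), le_abs_self (Real.log u),
      abs_nonneg (Real.log l), abs_nonneg (Real.log u)]
  · rw [log_im]; exact abs_arg_le_pi _

theorem arg_pos_of_im_pos {w : ℂ} (h : 0 < w.im) : 0 < arg w := by
  refine lt_of_le_of_ne (arg_nonneg_iff.2 h.le) fun h0 => ?_
  exact h.ne' (arg_eq_zero_iff.1 h0.symm).2

theorem arg_lt_pi_of_im_pos {w : ℂ} (h : 0 < w.im) : arg w < Real.pi :=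
  arg_lt_pi_iff.2 (Or.inr h.ne')

/-! ### The sum `w₊ + w₋` and the sign of `Re w₊` -/

theorem log_add_log {z : ℂ} (hz : z ∈ upperHalf) (i : ℕ) :
    Complex.log (c.a (i + 1) * c.mPlusAt (i + 1) z)
      + Complex.log (c.a (i + 1) * c.mMinusAt (i + 1) z)
      = I * Real.pi + (Complex.log (c.green (i + 1) z) - Complex.log (c.green i z)) := by
  rw [a_mul_mPlusAt, a_mul_mMinusAt]
  have p1 := c.fPlus_ratio_im_pos hz (i + 1)
  have p2 := c.fMinus_ratio_im_pos hz i
  have q1 := c.green_im_pos hz (i + 1)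
  have q2 := c.green_im_pos hz i
  have ne : ∀ {w : ℂ}, 0 < w.im → w ≠ 0 := fun h h0 => by simp [h0] at h
  -- With `iπ` moved to the left, both sides have imaginary part in `(-π, π)`, so no multiple of
  -- `2πi` can intervene and it suffices to compare exponentials.
  rw [← sub_eq_iff_eq_add']
  refine Complex.exp_inj_of_neg_pi_lt_of_le_pi ?_ ?_ ?_ ?_ ?_
  · simp only [sub_im, add_im, log_im, I_mul_im, ofReal_re]
    linarith [arg_pos_of_im_pos p1, arg_pos_of_im_pos p2]
  · simp only [sub_im, add_im, log_im, I_mul_im, ofReal_re]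
    linarith [arg_lt_pi_of_im_pos p1, arg_lt_pi_of_im_pos p2]
  · simp only [sub_im, log_im]
    linarith [arg_lt_pi_of_im_pos q2, arg_pos_of_im_pos q1]
  · simp only [sub_im, log_im]
    linarith [arg_lt_pi_of_im_pos q1, arg_pos_of_im_pos q2]
  · rw [Complex.exp_sub, Complex.exp_add, Complex.exp_sub, Complex.exp_log (ne p1),
      Complex.exp_log (ne p2), Complex.exp_log (ne q1), Complex.exp_log (ne q2), mul_comm I,
      Complex.exp_pi_mul_I, c.green_eq hz, c.green_eq hz]
    have h1 := c.fMinus_ne_zero hz i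
    have h2 := c.fPlus_ne_zero hz (i + 1)
    field_simp

theorem wPlusN_add_wMinusN {z : ℂ} (hz : z ∈ upperHalf) {N : ℕ} (hN : N ≠ 0) :
    c.wPlusN N z + c.wMinusN N z = I * Real.pi
      + (1 / N : ℂ) * (Complex.log (c.green N z) - Complex.log (c.green 0 z)) := by
  have h : ∀ N : ℕ, ∑ n ∈ Finset.Icc 1 N, (Complex.log (c.a n * c.mPlusAt n z)
      + Complex.log (c.a n * c.mMinusAt n z)) = N * (I * Real.pi)
        + (Complex.log (c.green N z) - Complex.log (c.green 0 z)) := by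
    intro N
    induction N with
    | zero => simp
    | succ N ih =>
      rw [Finset.sum_Icc_succ_top (by omega), ih, c.log_add_log hz]
      push_cast
      ring
  have hN' : (N : ℂ) ≠ 0 := Nat.cast_ne_zero.2 hN
  rw [wPlusN, wMinusN, ← mul_add, ← Finset.sum_add_distrib, h]
  field_simp

theorem tendsto_one_div_mul_of_bounded {N : ℕ → ℕ} (hN : Tendsto N atTop atTop) {u : ℕ → ℂ}
    {B : ℝ} (hu : ∀ n, ‖u n‖ ≤ B) :
    Tendsto (fun j => (1 / N j : ℂ) * u (N j)) atTop (𝓝 0) := by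
  have h1 : Tendsto (fun j => (1 / (N j : ℝ)) * B) atTop (𝓝 0) := by
    simpa using (tendsto_one_div_atTop_nhds_zero_nat.comp hN).mul_const B
  refine squeeze_zero_norm (fun j => ?_) h1
  rw [norm_mul, norm_div, norm_one, norm_natCast]
  exact mul_le_mul_of_nonneg_left (hu _) (by positivity)

theorem tendsto_wPlusN_add_wMinusN {N : ℕ → ℕ} (hN : Tendsto N atTop atTop) {z : ℂ}
    (hz : z ∈ upperHalf) :
    Tendsto (fun j => c.wPlusN (N j) z + c.wMinusN (N j) z) atTop (𝓝 (I * Real.pi)) := by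
  obtain ⟨B, hB⟩ := c.exists_norm_log_green_le hz
  have h := tendsto_one_div_mul_of_bounded hN
    (u := fun n => Complex.log (c.green n z) - Complex.log (c.green 0 z))
    (fun n => (norm_sub_le _ _).trans (add_le_add (hB n) (hB 0)))
  have h2 := h.const_add (I * Real.pi)
  rw [add_zero] at h2
  refine h2.congr' ?_
  -- At `N = 0` both averages are `0` and the identity fails.
  filter_upwards [hN.eventually_ne_atTop 0] with j hj
  rw [c.wPlusN_add_wMinusN hz hj]

theorem wPlusN_re {z : ℂ} (hz : z ∈ upperHalf) (N : ℕ) :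
    (c.wPlusN N z).re
      = (1 / N : ℝ) * (Real.log ‖c.fPlus (N + 1) z‖ - Real.log ‖c.fPlus 1 z‖) := by
  have h1 : (∑ n ∈ Finset.Icc 1 N, Complex.log (c.a n * c.mPlusAt n z)).re
      = Real.log ‖c.fPlus (N + 1) z‖ - Real.log ‖c.fPlus 1 z‖ := by
    induction N with
    | zero => simp
    | succ N ih =>
      rw [Finset.sum_Icc_succ_top (by omega), add_re, ih, a_mul_mPlusAt, log_re, norm_neg,
        norm_div, Real.log_div (norm_ne_zero_iff.2 (c.fPlus_ne_zero hz _))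
          (norm_ne_zero_iff.2 (c.fPlus_ne_zero hz _))]
      ring
  have e : (1 / N : ℂ) = ((1 / N : ℝ) : ℂ) := by push_cast; rfl
  rw [wPlusN, e, re_ofReal_mul, h1]

/-- The Lyapunov exponent is nonnegative since `f₊` decays. -/
theorem re_nonpos_of_tendsto_wPlusN {N : ℕ → ℕ} (hN : Tendsto N atTop atTop) {z w : ℂ}
    (hz : z ∈ upperHalf) (h : Tendsto (fun j => c.wPlusN (N j) z) atTop (𝓝 w)) : w.re ≤ 0 := by
  have h1 := (continuous_re.tendsto _).comp h
  have h2 : Tendsto (fun j => (1 / (N j : ℝ)) * -Real.log ‖c.fPlus 1 z‖) atTop (𝓝 0) := by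
    simpa using (tendsto_one_div_atTop_nhds_zero_nat.comp hN).mul_const (-Real.log ‖c.fPlus 1 z‖)
  have h3 : ∀ᶠ n in atTop, ‖c.fPlus n z‖ ≤ 1 := by
    have := (c.tendsto_fPlus hz).norm
    rw [norm_zero] at this
    exact this.eventually_le_const one_pos
  refine le_of_tendsto_of_tendsto h1 h2 ?_
  filter_upwards [((tendsto_add_atTop_nat 1).comp hN).eventually h3] with j hj
  rw [Function.comp_apply, c.wPlusN_re hz]
  refine mul_le_mul_of_nonneg_left ?_ (by positivity)
  have := Real.log_nonpos (norm_nonneg _) hj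
  simp only [Function.comp_apply] at this
  linarith

/-! ### Derivatives in `z` and the identity `g = -w₋'` -/

theorem differentiable_fMinus (n : ℕ) : Differentiable ℂ (c.fMinus n) := by
  induction n using Nat.twoStepInduction with
  | zero => exact differentiable_const _
  | one => exact differentiable_const _
  | more n ih1 ih2 =>
    exact (((differentiable_id.sub_const _).mul ih2).sub (ih1.const_mul _)).div_const _

theorem deriv_fMinus_zero (z : ℂ) : deriv (c.fMinus 0) z = 0 := deriv_const z (0 : ℂ)

theorem deriv_fMinus_one (z : ℂ) : deriv (c.fMinus 1) z = 0 := deriv_const z (1 : ℂ)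

theorem deriv_fMinus_recurrence (z : ℂ) (n : ℕ) :
    c.a (n + 1) * deriv (c.fMinus (n + 2)) z + c.a n * deriv (c.fMinus n) z
      = c.fMinus (n + 1) z + (z - c.b (n + 1)) * deriv (c.fMinus (n + 1)) z := by
  have d := fun n => (c.differentiable_fMinus n z).hasDerivAt
  have h1 := ((d (n + 2)).const_mul (c.a (n + 1) : ℂ)).add ((d n).const_mul (c.a n : ℂ))
  have h2 := ((hasDerivAt_id z).sub_const (c.b (n + 1) : ℂ)).mul (d (n + 1))
  have e : (fun w => (c.a (n + 1) : ℂ) * c.fMinus (n + 2) w + c.a n * c.fMinus n w)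
      = fun w => (w - c.b (n + 1)) * c.fMinus (n + 1) w := by
    ext w
    exact c.sol_recurrence 0 1 w n
  have h3 := h1.congr_of_eventuallyEq (f₁ := fun w => (w - c.b (n + 1)) * c.fMinus (n + 1) w)
    (Eventually.of_forall fun w => (congrFun e w).symm)
  have := h3.unique h2
  rw [one_mul] at this
  exact this

/-- Of Christoffel–Darboux type: crossing the differentiated equation for `f₋` with the equation for
`f₊` turns the summand into a difference of consecutive terms. -/
theorem sum_fPlus_mul_fMinus (z : ℂ) (N : ℕ) :
    ∑ i ∈ Finset.range N, -(c.fPlus (i + 1) z * c.fMinus (i + 1) z)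
      = c.a N * (c.fPlus (N + 1) z * deriv (c.fMinus N) z
        - c.fPlus N z * deriv (c.fMinus (N + 1)) z) := by
  induction N with
  | zero => simp [deriv_fMinus_zero, deriv_fMinus_one]
  | succ N ih =>
    rw [Finset.sum_range_succ, ih]
    have h1 := c.sol_recurrence 1 (-c.mPlus z) z N
    have h2 := c.deriv_fMinus_recurrence z N
    simp only [fPlus] at h1 ⊢
    linear_combination c.sol 1 (-c.mPlus z) z (N + 1) * h2 - deriv (c.fMinus (N + 1)) z * h1

theorem hasDerivAt_fMinus_ratio {z : ℂ} (hz : z ∈ upperHalf) (n : ℕ) :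
    HasDerivAt (fun w => c.fMinus (n + 2) w / c.fMinus (n + 1) w)
      (c.fMinus (n + 2) z / c.fMinus (n + 1) z *
        (deriv (c.fMinus (n + 2)) z / c.fMinus (n + 2) z
          - deriv (c.fMinus (n + 1)) z / c.fMinus (n + 1) z)) z := by
  have d := fun n => (c.differentiable_fMinus n z).hasDerivAt
  have h1 := c.fMinus_ne_zero hz n
  have h2 := c.fMinus_ne_zero hz (n + 1)
  have h := (d (n + 2)).div (d (n + 1)) h1
  refine h.congr_deriv ?_
  field_simp

theorem hasDerivAt_wMinusN {z : ℂ} (hz : z ∈ upperHalf) (N : ℕ) :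
    HasDerivAt (c.wMinusN N)
      ((1 / N : ℂ) * (deriv (c.fMinus (N + 1)) z / c.fMinus (N + 1) z)) z := by
  refine HasDerivAt.const_mul _ ?_
  induction N with
  | zero => simpa [deriv_fMinus_one] using hasDerivAt_const z (0 : ℂ)
  | succ N ih =>
    simp only [Finset.sum_Icc_succ_top (Nat.le_add_left 1 N)]
    have h0 := c.fMinus_ratio_im_pos hz N
    have h1 := (c.hasDerivAt_fMinus_ratio hz N).clog (mem_slitPlane_iff.2 (Or.inr h0.ne'))
    rw [mul_div_cancel_left₀ _ (fun h => by simp [h] at h0)] at h1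
    have h2 := ih.add h1
    simp only [a_mul_mMinusAt] at h2 ⊢
    refine h2.congr_deriv ?_
    ring

/-- The Wronskian rewrites the telescoped sum as minus the logarithmic derivative of `f₋` plus an
error. The error contains only the logarithmic derivative of one ratio of consecutive values, which
stays bounded in `n`. -/
theorem green_sum_add_deriv {z : ℂ} (hz : z ∈ upperHalf) (n : ℕ) :
    (∑ i ∈ Finset.range (n + 1), c.green i z)
        + deriv (c.fMinus (n + 2)) z / c.fMinus (n + 2) z
      = c.fPlus (n + 2) z / c.fPlus (n + 1) z * (c.a (n + 1) * c.green n z) *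
        (deriv (c.fMinus (n + 2)) z / c.fMinus (n + 2) z
          - deriv (c.fMinus (n + 1)) z / c.fMinus (n + 1) z) := by
  simp only [c.green_eq hz]
  rw [sum_fPlus_mul_fMinus]
  have h := c.wronskian z (n + 1)
  have h1 := c.fMinus_ne_zero hz n
  have h2 := c.fMinus_ne_zero hz (n + 1)
  have h3 := c.fPlus_ne_zero hz (n + 1)
  field_simp
  linear_combination deriv (c.fMinus (n + 2)) z * h

theorem exists_norm_green_sum_add_deriv_le {z : ℂ} (hz : z ∈ upperHalf) :
    ∃ B : ℝ, ∀ n, ‖(∑ i ∈ Finset.range n, c.green i z)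
      + deriv (c.fMinus (n + 1)) z / c.fMinus (n + 1) z‖ ≤ B := by
  have hz' : 0 < z.im := hz
  obtain ⟨K, hK1, hK', hK, hb⟩ := c.exists_bound
  have hK0 : 0 < K := by linarith
  set r := z.im / 2 with hr
  have hr0 : 0 < r := half_pos hz'
  -- This bounds the `f₋` ratio on the whole closed disc of radius `r` about `z`, where `Im w ≥ r`
  -- and `‖w‖ ≤ ‖z‖ + r`.
  set U := K * ((‖z‖ + r) + K + K * (K / r))
  have hU : 0 ≤ U := by positivity
  have hball : ∀ w ∈ Metric.closedBall z r, r ≤ w.im ∧ ‖w‖ ≤ ‖z‖ + r := by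
    intro w hw
    rw [mem_closedBall_iff_norm] at hw
    have h1 := (Complex.abs_im_le_norm (w - z)).trans hw
    rw [sub_im] at h1
    constructor
    · linarith [(abs_le.1 h1).1]
    · have := norm_add_le z (w - z)
      rw [add_sub_cancel] at this
      linarith
  have hup : ∀ w ∈ Metric.closedBall z r, w ∈ upperHalf := fun w hw =>
    hr0.trans_le (hball w hw).1
  refine ⟨(K / z.im) * (K * (K⁻¹ * (z.im / K))⁻¹) * ((U / r) * (K / z.im)), fun n => ?_⟩
  rcases n with _ | n
  · simp only [Finset.range_zero, Finset.sum_empty, zero_add, deriv_fMinus_one, zero_div, norm_zero]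
    positivity
  rw [c.green_sum_add_deriv hz, norm_mul, norm_mul, norm_mul]
  have e1 : ‖(c.a (n + 1) : ℂ)‖ ≤ K := by
    rw [norm_real, Real.norm_of_nonneg (c.a_pos _).le]; exact hK _
  have e2 : ‖c.green n z‖ ≤ (K⁻¹ * (z.im / K))⁻¹ := by
    have := c.le_norm_green_inv hK hK' hz n
    rw [norm_inv] at this
    exact le_inv_of_le_inv₀ (by positivity) this
  have hd := c.hasDerivAt_fMinus_ratio hz n
  -- Cauchy's estimate on that disc. Together with the lower bound `e4` on the ratio it controls the
  -- logarithmic derivative.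
  have e3 : ‖deriv (fun w => c.fMinus (n + 2) w / c.fMinus (n + 1) w) z‖ ≤ U / r := by
    refine norm_deriv_le_of_forall_mem_sphere_norm_le hr0 ?_ fun w hw => ?_
    · refine DifferentiableOn.diffContOnCl fun w hw => ?_
      rw [closure_ball _ hr0.ne'] at hw
      exact (c.hasDerivAt_fMinus_ratio (hup w hw) n).differentiableAt.differentiableWithinAt
    · have hw' := Metric.sphere_subset_closedBall hw
      refine (c.norm_fMinus_ratio_le hK hK' hb (hup w hw') n).trans ?_
      have h1 := (hball w hw').1
      have h2 := (hball w hw').2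
      have h3 : K / w.im ≤ K / r := div_le_div_of_nonneg_left hK0.le hr0 h1
      exact mul_le_mul_of_nonneg_left
        (add_le_add (add_le_add h2 le_rfl) (mul_le_mul_of_nonneg_left h3 hK0.le)) hK0.le
  rw [hd.deriv, norm_mul] at e3
  have e4 : z.im / K ≤ ‖c.fMinus (n + 2) z / c.fMinus (n + 1) z‖ :=
    (c.le_fMinus_ratio_im hK hz n).trans ((le_abs_self _).trans (abs_im_le_norm _))
  have e5 : ‖deriv (c.fMinus (n + 2)) z / c.fMinus (n + 2) z
      - deriv (c.fMinus (n + 1)) z / c.fMinus (n + 1) z‖ ≤ (U / r) * (K / z.im) := by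
    have := (mul_le_mul_of_nonneg_right e4 (norm_nonneg _)).trans e3
    rw [← inv_div z.im K, ← div_eq_mul_inv, le_div_iff₀ (by positivity), mul_comm]
    exact this
  refine mul_le_mul (mul_le_mul (c.norm_fPlus_ratio_le hK hz _)
    (mul_le_mul e1 e2 (norm_nonneg _) hK0.le) (by positivity) (by positivity)) e5
    (norm_nonneg _) (by positivity)

theorem tendsto_gN_add_deriv {N : ℕ → ℕ} (hN : Tendsto N atTop atTop) {z : ℂ}
    (hz : z ∈ upperHalf) :
    Tendsto (fun j => c.gN (N j) z + deriv (c.wMinusN (N j)) z) atTop (𝓝 0) := by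
  obtain ⟨B, hB⟩ := c.exists_norm_green_sum_add_deriv_le hz
  refine (tendsto_one_div_mul_of_bounded hN hB).congr fun j => ?_
  rw [(c.hasDerivAt_wMinusN hz _).deriv, gN, mul_add]

end JacobiCoeff

/-! ### Holomorphic functions on the half plane -/

theorem TendstoOnCompacts.tendsto {F : ℕ → ℂ → ℂ} {G : ℂ → ℂ} (h : TendstoOnCompacts F G) {z : ℂ}
    (hz : z ∈ upperHalf) : Tendsto (fun j => F j z) atTop (𝓝 (G z)) :=
  (h {z} (Set.singleton_subset_iff.2 hz) isCompact_singleton).tendsto_at rfl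

theorem TendstoOnCompacts.tendsto_deriv {F : ℕ → ℂ → ℂ} {G : ℂ → ℂ} (h : TendstoOnCompacts F G)
    (hF : ∀ j, DifferentiableOn ℂ (F j) upperHalf) {z : ℂ} (hz : z ∈ upperHalf) :
    Tendsto (fun j => deriv (F j) z) atTop (𝓝 (deriv G z)) :=
  (((tendstoLocallyUniformlyOn_iff_forall_isCompact isOpen_upperHalf).2 h).deriv
    (Eventually.of_forall hF) isOpen_upperHalf).tendsto_at hz

/-- A holomorphic function on `ℂ⁺` with vanishing real part is constant. -/
theorem eq_const_of_re_eq_zero {H : ℂ → ℂ} (hH : DifferentiableOn ℂ H upperHalf)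
    (h0 : ∀ z ∈ upperHalf, (H z).re = 0) {z w : ℂ} (hz : z ∈ upperHalf) (hw : w ∈ upperHalf) :
    H z = H w := by
  refine isOpen_upperHalf.is_const_of_deriv_eq_zero isPreconnected_upperHalf hH (fun v hv => ?_)
    hz hw
  have hd := (hH.differentiableAt (isOpen_upperHalf.mem_nhds hv)).hasDerivAt
  -- The function `exp H` has modulus `1` everywhere, so it is constant by the maximum principle;
  -- its derivative `exp H · H'` then forces `H' = 0`.
  have hexp : Set.EqOn (fun z => Complex.exp (H z)) (Function.const ℂ (Complex.exp (H v)))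
      upperHalf := by
    refine Complex.eqOn_of_isPreconnected_of_isMaxOn_norm isPreconnected_upperHalf
      isOpen_upperHalf hH.cexp hv fun u hu => ?_
    simp [Complex.norm_exp, h0 u hu, h0 v hv]
  have h1 := hd.cexp.congr_of_eventuallyEq (f₁ := Function.const ℂ (Complex.exp (H v)))
    (by
      filter_upwards [isOpen_upperHalf.mem_nhds hv] with u hu
      exact (hexp hu).symm)
  have h2 := h1.unique (hasDerivAt_const v (Complex.exp (H v)))
  exact (mul_eq_zero.1 h2).resolve_left (Complex.exp_ne_zero _)

/-- If `Re w ≤ 0` and `Im w' > 0` on `ℂ⁺` then `Re w < 0` on `ℂ⁺`. -/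
theorem re_neg_of_re_nonpos {w : ℂ → ℂ} (hw : DifferentiableOn ℂ w upperHalf)
    (h0 : ∀ z ∈ upperHalf, (w z).re ≤ 0) (h1 : ∀ z ∈ upperHalf, 0 < (deriv w z).im)
    {z : ℂ} (hz : z ∈ upperHalf) : (w z).re < 0 := by
  have hz' : 0 < z.im := hz
  -- By Cauchy–Riemann `∂_y Re w = -Im w'`, so `Re w` strictly decreases upwards and can be compared
  -- with its value at half the height.
  have hd : ∀ y : ℝ, 0 < y → HasDerivAt (fun y : ℝ => (w (z.re + y * I)).re)
      (-(deriv w (z.re + y * I)).im) y := by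
    intro y hy
    have h2 := (hw.differentiableAt
      (isOpen_upperHalf.mem_nhds (ofReal_add_mul_I_mem (x := z.re) hy))).hasDerivAt
    have h3 : HasDerivAt (fun y : ℂ => (z.re : ℂ) + y * I) I (y : ℂ) := by
      simpa using ((hasDerivAt_id (y : ℂ)).mul_const I).const_add (z.re : ℂ)
    have h4 := (HasDerivAt.comp (y : ℂ) h2 h3).real_of_complex
    simpa using h4
  have hanti : StrictAntiOn (fun y : ℝ => (w (z.re + y * I)).re) (Set.Ioi 0) := by
    refine strictAntiOn_of_deriv_neg (convex_Ioi 0)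
      (fun y hy => (hd y hy).continuousAt.continuousWithinAt) fun y hy => ?_
    rw [interior_Ioi] at hy
    rw [(hd y hy).deriv, neg_lt_zero]
    exact h1 _ (ofReal_add_mul_I_mem hy)
  have h5 := hanti (half_pos hz') hz' (half_lt_self hz')
  simp only [re_add_im] at h5
  exact h5.trans_le (h0 _ (ofReal_add_mul_I_mem (half_pos hz')))

end

/-! ### Assembly of the limits -/

theorem theorem3p2
    (c : JacobiCoeff) (N : ℕ → ℕ) (hN : Tendsto N atTop atTop)
    (wp wm g : ℂ → ℂ) (ν ktilde : Measure ℝ)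
    [IsProbabilityMeasure ν] [IsProbabilityMeasure ktilde] (A : ℝ)
    (hwp : IsHerglotz wp) (hWP : TendstoOnCompacts (fun j => c.wPlusN (N j)) wp)
    (hwm : IsHerglotz wm) (hWM : TendstoOnCompacts (fun j => c.wMinusN (N j)) wm)
    (hg : IsHerglotz g) (hG : TendstoOnCompacts (fun j => c.gN (N j)) g)
    (hNu : TendstoWeakStar (fun j => c.nuN (N j)) ν)
    (hK : TendstoWeakStar (fun j => c.kN (N j)) ktilde)
    (hA : 0 < A)
    (hAlim : Tendsto (fun j => (∏ n ∈ Finset.Icc 1 (N j), c.a n) ^ (1 / (N j : ℝ)))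
      atTop (𝓝 A))
    (γ k : ℂ → ℝ)
    (hγk : ∀ z ∈ upperHalf, wp z = -(γ z : ℂ) + I * Real.pi * (k z : ℂ)) :
    ∃ (κ : ℝ → ℝ) (hκ : Monotone κ),
      (∀ t : ℝ, Tendsto (fun y : ℝ => k (t + y * I)) (𝓝[>] 0) (𝓝 (κ t))) ∧
      IsHerglotz (fun z => -I * wp z) ∧
      IsHerglotz (deriv wp) ∧
      (∀ z ∈ upperHalf, wp z + wm z = I * Real.pi) ∧
      (∀ z ∈ upperHalf, g z = deriv wp z) ∧
      ktilde = hκ.stieltjesFunction.measure ∧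
      ν = hκ.stieltjesFunction.measure ∧
      (∀ z ∈ upperHalf,
        Integrable (fun t : ℝ => 1 / ((t : ℂ) - z)) hκ.stieltjesFunction.measure ∧
        g z = ∫ t : ℝ, 1 / ((t : ℂ) - z) ∂hκ.stieltjesFunction.measure) ∧
      (∀ z ∈ upperHalf,
        Integrable (fun t : ℝ => Complex.log ((t : ℂ) - z)) hκ.stieltjesFunction.measure ∧
        wp z = (Real.log A : ℂ) -
          ∫ t : ℝ, Complex.log ((t : ℂ) - z) ∂hκ.stieltjesFunction.measure) := by
  have sPm : ∀ z ∈ upperHalf, wp z + wm z = I * Real.pi := fun z hz =>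
    tendsto_nhds_unique ((hWP.tendsto hz).add (hWM.tendsto hz))
      (c.tendsto_wPlusN_add_wMinusN hN hz)
  have hdp : ∀ z ∈ upperHalf, deriv wp z = -deriv wm z := by
    intro z hz
    have h1 := (hwm.1.differentiableAt (isOpen_upperHalf.mem_nhds hz)).hasDerivAt.const_sub
      (I * Real.pi)
    refine (h1.congr_of_eventuallyEq ?_).deriv
    filter_upwards [isOpen_upperHalf.mem_nhds hz] with u hu
    exact eq_sub_of_add_eq (sPm u hu)
  have hgd : ∀ z ∈ upperHalf, g z = deriv wp z := by
    intro z hz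
    have h1 := hWM.tendsto_deriv (fun j z hz =>
      (c.hasDerivAt_wMinusN hz _).differentiableAt.differentiableWithinAt) hz
    have h2 := tendsto_nhds_unique ((hG.tendsto hz).add h1) (c.tendsto_gN_add_deriv hN hz)
    rw [hdp z hz]
    exact eq_neg_of_add_eq_zero_left h2
  have hdH : IsHerglotz (deriv wp) :=
    ⟨hwp.1.deriv isOpen_upperHalf, fun z hz => hgd z hz ▸ hg.2 hz⟩
  have hneg : ∀ z ∈ upperHalf, (wp z).re < 0 := fun z hz =>
    re_neg_of_re_nonpos hwp.1
      (fun z hz => c.re_nonpos_of_tendsto_wPlusN hN hz (hWP.tendsto hz))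
      (fun z hz => hdH.2 hz) hz
  obtain ⟨M, hM, hre⟩ := c.tendsto_wMinusN_re hA hK hAlim
  obtain ⟨hMν, hgν⟩ := c.stieltjes_of_tendsto hNu
  have hpi := Real.pi_pos
  -- The defect of the logarithmic representation. Its real part vanishes by the eigenvalue formula
  -- for `Re w₋`, so only an imaginary constant remains.
  set H : ℂ → ℂ := fun z => wp z + logPotential ktilde z - Real.log A with hH
  have hHd : DifferentiableOn ℂ H upperHalf := (hwp.1.add fun z hz =>
    (hasDerivAt_logPotential hM hz).differentiableAt.differentiableWithinAt).sub_const _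
  have hH0 : ∀ z ∈ upperHalf, (H z).re = 0 := by
    intro z hz
    have h1 := tendsto_nhds_unique
      ((continuous_re.tendsto _).comp (hWM.tendsto hz)) (hre z hz)
    have h2 := congrArg re (sPm z hz)
    rw [add_re, h1, I_mul_re, ofReal_im, neg_zero] at h2
    rw [hH, sub_re, add_re, ofReal_re]
    linarith
  have hI : (I : ℂ) ∈ upperHalf := by simp [upperHalf]
  have him : ∀ z ∈ upperHalf, (wp z).im = (H I).im - (logPotential ktilde z).im := by
    intro z hz
    rw [← eq_const_of_re_eq_zero hHd hH0 hz hI, hH, sub_im, add_im, ofReal_im]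
    ring
  have hbv : ∀ t : ℝ, Tendsto (fun y : ℝ => (wp (t + y * I)).im) (𝓝[>] 0)
      (𝓝 ((H I).im + Real.pi * midCdf ktilde t)) := by
    intro t
    have h1 := (tendsto_logPotential_im hM t).const_sub (H I).im
    rw [sub_neg_eq_add] at h1
    refine h1.congr' ?_
    filter_upwards [self_mem_nhdsWithin] with y hy
    rw [him _ (ofReal_add_mul_I_mem hy)]
  have hbounds : ∀ t : ℝ, 0 ≤ (H I).im + Real.pi * midCdf ktilde t ∧
      (H I).im + Real.pi * midCdf ktilde t ≤ Real.pi := by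
    intro t
    constructor
    · refine ge_of_tendsto (hbv t) ?_
      filter_upwards [self_mem_nhdsWithin] with y hy
      exact le_of_lt (hwp.2 (ofReal_add_mul_I_mem hy))
    · refine le_of_tendsto (hbv t) ?_
      filter_upwards [self_mem_nhdsWithin] with y hy
      have h1 := congrArg im (sPm _ (ofReal_add_mul_I_mem (x := t) hy))
      have h2 : 0 < (wm (t + y * I)).im := hwm.2 (ofReal_add_mul_I_mem hy)
      rw [add_im, I_mul_im, ofReal_re] at h1
      linarith
  -- To the left of the support the lower bound gives `Im H ≥ 0`; to the right the mass is `1`, and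
  -- the upper bound gives `Im H ≤ 0`.
  have hHI : (H I).im = 0 := by
    have h1 := (hbounds (-M - 1)).1
    have h2 := (hbounds (M + 1)).2
    rw [midCdf_eq_zero hM (by linarith)] at h1
    rw [midCdf_eq_one hM (by linarith)] at h2
    linarith
  have hwpF : ∀ z ∈ upperHalf, wp z = Real.log A - logPotential ktilde z := by
    intro z hz
    have h1 : H z = 0 :=
      (eq_const_of_re_eq_zero hHd hH0 hz hI).trans (Complex.ext (hH0 I hI) hHI)
    linear_combination h1
  have hwpd : ∀ z ∈ upperHalf, deriv wp z = ∫ t : ℝ, 1 / ((t : ℂ) - z) ∂ktilde := by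
    intro z hz
    have h1 := (hasDerivAt_logPotential hM hz).const_sub (Real.log A : ℂ)
    rw [neg_neg] at h1
    refine (h1.congr_of_eventuallyEq ?_).deriv
    filter_upwards [isOpen_upperHalf.mem_nhds hz] with u hu using hwpF u hu
  have hνk : ν = ktilde := by
    refine eq_of_stieltjes_eq (M := max M ‖c.op‖)
      (hMν.mono fun t ht => ht.trans (le_max_right _ _))
      (hM.mono fun t ht => ht.trans (le_max_left _ _)) fun z hz => ?_
    rw [← hwpd z hz, ← hgd z hz]
    exact tendsto_nhds_unique (hgν z hz) (hG.tendsto hz)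
  have hdk : (monotone_midCdf ktilde).stieltjesFunction.measure = ktilde :=
    stieltjesFunction_midCdf_measure ktilde _ rfl
  -- At an atom the vertical limit of `k` is the mean of the one-sided limits, so the witness is the
  -- midpoint distribution function and not the right-continuous one.
  refine ⟨midCdf ktilde, monotone_midCdf ktilde, fun t => ?_, ⟨hwp.1.const_mul _, fun z hz => ?_⟩,
    hdH, sPm, hgd, hdk.symm, hνk.trans hdk.symm, fun z hz => ?_, fun z hz => ?_⟩
  · have h1 := (hbv t).div_const Real.pi
    rw [hHI, zero_add, mul_div_cancel_left₀ _ hpi.ne'] at h1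
    refine h1.congr' ?_
    filter_upwards [self_mem_nhdsWithin] with y hy
    have h2 := congrArg im (hγk _ (ofReal_add_mul_I_mem (x := t) hy))
    rw [h2, div_eq_iff hpi.ne']
    simp [mul_comm]
  · change 0 < (-I * wp z).im
    rw [neg_mul, neg_im, I_mul_im]
    linarith [hneg z hz]
  · rw [hdk]
    exact ⟨integrable_of_ae_abs_le hM (continuous_inv_sub hz), (hgd z hz).trans (hwpd z hz)⟩
  · rw [hdk]
    exact ⟨integrable_of_ae_abs_le hM (continuous_log_sub hz), hwpF z hz⟩
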